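/- Throughout, $k$ is a field, algebras are unital and associative over $k$, and Sweedler notation is used. **Definitions.** Let $A$ be a $k$-algebra. An $(s,t)$-ring over $A$ is a $k$-algebra $U$ with $k$-algebra maps $s:A\to U$, $t:A^{op}\to U$ such that $s(a)t(b)=t(b)s(a)$ for all $a,b\in A$; it is regarded as an $(A,A)$-bimodule by $a\cdot u\cdot b:=s(a)t(b)u$, and tensor products $\otimes_A$ below are taken for this bimodule structure. A *left bialgebroid* $(U,A,s,t,\Delta,\epsilon)$ is an $(s,t)$-ring $U$ with a coassociative counital coalgebra structure $\Delta:U\to U\otimes_AU$, $\epsilon:U\to A$ in the category of $(A,A)$-bimodules such that - $u_{(1)}t(a)\otimes u_{(2)}=u_{(1)}\otimes u_{(2)}s(a)$ for all $u\in U$, $a\in A$, $\Delta(1)=1\otimes 1$, and $\Delta(uv)=u_{(1)}v_{(1)}\otimes u_{(2)}v_{(2)}$; - $\epsilon(1)=1$ and $\epsilon(u\,s(\epsilon(v)))=\epsilon(uv)=\epsilon(u\,t(\epsilon(v)))$. A *Hopf algebroid* $\mathcal U=(U,A,s,t,\Delta,\epsilon,S)$ is a left bialgebroid with an involutive anti-automorphism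 $S$ of the $k$-algebra $U$ such that $S\circ t=s$ and, in $U\otimes_AU$, for all $u\in U$, $$S(u_{(1)})_{(1)}u_{(2)}\otimes S(u_{(1)})_{(2)}=1\otimes S(u),\qquad S(u_{(2)})_{(1)}\otimes S(u_{(2)})_{(2)}u_{(1)}=S(u)\otimes 1 .$$ The Kowalzig–Posthuma *cocyclic module* $C^\bullet(\mathcal U)$ has $C^0(\mathcal U)=A$ and $C^n(\mathcal U)=U\otimes_A\cdots\otimes_AU$ ($n$ factors) for $n\ge1$. Its cofaces $\delta_i:C^n\to C^{n+1}$, $0\le i\le n+1$, are, for $n\ge 1$, $$\delta_0(u^1\otimes\cdots\otimes u^n)=1\otimes u^1\otimes\cdots\otimes u^n,\quad \delta_i(u^1\otimes\cdots\otimes u^n)=u^1\otimes\cdots\otimes\Delta(u^i)\otimes\cdots\otimes u^n\ (1\le i\le n),\quad \delta_{n+1}(u^1\otimes\cdots\otimes u^n)=u^1\otimes\cdots\otimes u^n\otimes 1,$$ and $\delta_0=t$, $\delta_1=s$ for $n=0$. Its codegeneracies $\sigma_i:C^n\to C^{n-1}$, $0\le i\le n-1$, apply $\epsilon$ to the factor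 $u^{i+1}$: $$\sigma_i(u^1\otimes\cdots\otimes u^n)=u^1\otimes\cdots\otimes\epsilon(u^{i+1})\cdot u^{i+2}\otimes\cdots\otimes u^n\quad(i<n-1),$$ while $\sigma_{n-1}(u^1\otimes\cdots\otimes u^n)=u^1\otimes\cdots\otimes u^{n-1}\cdot\epsilon(u^n)$ if $n\ge 2$, and $\sigma_0=\epsilon$ if $n=1$. Its cocyclic operators are $$\tau_n(u^1\otimes\cdots\otimes u^n)=S(u^1)_{(1)}u^2\otimes\cdots\otimes S(u^1)_{(n-1)}u^n\otimes S(u^1)_{(n)}\quad(n\ge1),\qquad\tau_0=\mathrm{id}.$$ $HH^\bullet(\mathcal U)$ is the cohomology of $(C^\bullet(\mathcal U),b)$ with $b=\sum_{i=0}^{n+1}(-1)^i\delta_i$ on $C^n$, and $HC^\bullet(\mathcal U)$ is the cohomology of the total complex of the cyclic bicomplex: the entry in column $p\ge0$ and row $q\ge 0$ is $C^q(\mathcal U)$, of total degree $p+q$, the vertical differentials are $b$ in even columns and $-b'$ in odd columns, with $b'=\sum_{i=0}^{q}(-1)^i\delta_i$ on $C^q$, and the horizontal differentials from column $p$ to column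 $p+1$ are $1-\lambda$ for even $p$ and $N=\sum_{i=0}^q\lambda^i$ for odd $p$, with $\lambda=(-1)^q\tau_q$ on $C^q$. Let $C$ be a cocommutative $k$-coalgebra with counit $\epsilon_C$. A *measuring* of algebras from $R$ to $R'$ by $C$ is a $k$-linear map $\psi:C\to\mathrm{Hom}_k(R,R')$, written $\psi(x)(a)=x(a)$, with $x(ab)=x_{(1)}(a)x_{(2)}(b)$ and $x(1)=\epsilon_C(x)1$. A *$C$-measuring* $(\Psi,\psi)$ from a Hopf algebroid $\mathcal U=(U,A,s,t,\Delta,\epsilon,S)$ to a Hopf algebroid $\mathcal U'=(U',A',s',t',\Delta',\epsilon',S')$ is a pair of measurings $\Psi:C\to\mathrm{Hom}_k(U,U')$, $\psi:C\to\mathrm{Hom}_k(A,A')$ such that, for all $x\in C$, $x\circ s=s'\circ x$, $x\circ t=t'\circ x$, $x\circ S=S'\circ x$, $x\circ\epsilon=\epsilon'\circ x$ and $x\circ\Delta=\Delta'\circ x$, where $x$ acts $U\otimes_AU\to U'\otimes_{A'}U'$ by the well-defined map $x(u\otimes v)=x_{(1)}(u)\otimes x_{(2)}(v)$. **Proposition.**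 Let $C$ be a cocommutative $k$-coalgebra and let $(\Psi,\psi)$ be a $C$-measuring from a Hopf algebroid $\mathcal U$ to a Hopf algebroid $\mathcal U'$. For every $x\in C$ the maps $$\overline\Psi^n(x):C^n(\mathcal U)\to C^n(\mathcal U'),\qquad u^1\otimes\cdots\otimes u^n\mapsto x_{(1)}(u^1)\otimes\cdots\otimes x_{(n)}(u^n)\quad(n\ge1),\qquad \overline\Psi^0(x)=\psi(x):A\to A',$$ are well defined and form a morphism of cocyclic modules $C^\bullet(\mathcal U)\to C^\bullet(\mathcal U')$, that is, they commute with all $\delta_i$, $\sigma_i$ and $\tau_n$. Consequently each $x\in C$ induces $k$-linear maps $$\overline\Psi^\bullet_{hoc}(x):HH^\bullet(\mathcal U)\to HH^\bullet(\mathcal U'),\qquad \overline\Psi^\bullet_{cy}(x):HC^\bullet(\mathcal U)\to HC^\bullet(\mathcal U'),$$ sending the class of a cocycle to the class of its image under (the entrywise application of) $\overline\Psi^\bullet(x)$. -/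

import Mathlib

open scoped TensorProduct
open MulOpposite

/-! ### Left modules and the tensor product over a noncommutative base algebra -/

/-- A left module over the `k`-algebra `A`, given as a `k`-vector space with an action of `A` by
`k`-linear maps. -/
structure LeftMod.{u, v} (k : Type v) (A : Type u) [Field k] [Ring A] [Algebra k A] where
  /-- the underlying space -/
  carrier : Type u
  [grp : AddCommGroup carrier]
  [mod : Module k carrier]
  /-- the action of `A` -/
  act : A →ₐ[k] Module.End k carrier

namespace LeftMod

universe u v
variable {k : Type v} {A : Type u} [Field k] [Ring A] [Algebra k A]

instance : CoeSort (LeftMod k A) (Type u) := ⟨carrier⟩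
@[reducible] instance (M : LeftMod k A) : AddCommGroup M := M.grp
@[reducible] instance (M : LeftMod k A) : Module k M := M.mod

/-- `A`-linear maps of left `A`-modules. -/
structure Hom (M N : LeftMod k A) where
  /-- the underlying `k`-linear map -/
  lin : M →ₗ[k] N
  map_act : ∀ (a : A) (m : M), lin (M.act a m) = N.act a (lin m)

/-- `A` as a left module over itself. -/
@[reducible] def unit (k : Type v) (A : Type u) [Field k] [Ring A] [Algebra k A] : LeftMod k A where
  carrier := A
  act := Algebra.lmul k A

end LeftMod

/-- An `(s,t)`-ring over `A`: algebra maps `s : A → U` and `t : Aᵒᵖ → U` with commuting images. -/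
structure SourceTargetRing.{u, v} (k : Type v) (A U : Type u) [Field k] [Ring A] [Algebra k A]
    [Ring U] [Algebra k U] where
  /-- source map -/
  s : A →ₐ[k] U
  /-- target map -/
  t : Aᵐᵒᵖ →ₐ[k] U
  s_t_comm : ∀ a b : A, s a * t (op b) = t (op b) * s a

namespace SourceTargetRing

universe u v
variable {k : Type v} {A U : Type u} [Field k] [Ring A] [Algebra k A] [Ring U] [Algebra k U]
variable (R : SourceTargetRing k A U)

/-- The relations `u · a ⊗ m = u ⊗ a · m`, where `u · a = t(a) u`. -/
def rel (M : LeftMod k A) : Submodule k (U ⊗[k] M) :=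
  Submodule.span k {z | ∃ (a : A) (u : U) (m : M),
    z = (R.t (op a) * u) ⊗ₜ[k] m - u ⊗ₜ[k] (M.act a m)}

/-- The `k`-vector space `U ⊗_A M`: the quotient of `U ⊗_k M` by `u · a ⊗ m = u ⊗ a · m`, for the
bimodule structure `a · u · b = s(a) t(b) u` on `U`. -/
def Tens (M : LeftMod k A) : Type u := (U ⊗[k] M) ⧸ R.rel M

instance (M : LeftMod k A) : AddCommGroup (R.Tens M) :=
  inferInstanceAs (AddCommGroup ((U ⊗[k] M) ⧸ R.rel M))
instance (M : LeftMod k A) : Module k (R.Tens M) :=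
  inferInstanceAs (Module k ((U ⊗[k] M) ⧸ R.rel M))

/-- The projection `U ⊗_k M → U ⊗_A M`. -/
def proj (M : LeftMod k A) : (U ⊗[k] M) →ₗ[k] R.Tens M := (R.rel M).mkQ

/-- The class of `u ⊗ m` in `U ⊗_A M`, bilinearly. -/
def tmul (M : LeftMod k A) : U →ₗ[k] M →ₗ[k] R.Tens M :=
  (TensorProduct.mk k U M).compr₂ (R.proj M)

lemma proj_tmul (M : LeftMod k A) (u : U) (m : M) : R.proj M (u ⊗ₜ m) = R.tmul M u m := rfl

lemma proj_surjective (M : LeftMod k A) : Function.Surjective (R.proj M) :=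
  Submodule.mkQ_surjective _

lemma tmul_act (M : LeftMod k A) (a : A) (u : U) (m : M) :
    R.tmul M (R.t (op a) * u) m = R.tmul M u (M.act a m) := by
  have h : (R.t (op a) * u) ⊗ₜ[k] m - u ⊗ₜ[k] (M.act a m) ∈ R.rel M :=
    Submodule.subset_span ⟨a, u, m, rfl⟩
  exact (Submodule.Quotient.eq _).2 h

lemma tensor_ext {M : LeftMod k A} {N : Type*} [AddCommGroup N] [Module k N]
    {f g : R.Tens M →ₗ[k] N}
    (h : ∀ u m, f (R.tmul M u m) = g (R.tmul M u m)) : f = g :=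
  Submodule.linearMap_qext _ (TensorProduct.ext' h)

/-- A bilinear map that is balanced over `A` factors through `U ⊗_A M`. -/
def lift {M : LeftMod k A} {N : Type*} [AddCommGroup N] [Module k N]
    (f : U →ₗ[k] M →ₗ[k] N) (hf : ∀ a u m, f (R.t (op a) * u) m = f u (M.act a m)) :
    R.Tens M →ₗ[k] N :=
  (R.rel M).liftQ (TensorProduct.lift f) (by
    rw [rel, Submodule.span_le]
    rintro _ ⟨a, u, m, rfl⟩
    simp [hf])

@[simp] lemma lift_tmul {M : LeftMod k A} {N : Type*} [AddCommGroup N] [Module k N]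
    (f : U →ₗ[k] M →ₗ[k] N) (hf) (u : U) (m : M) :
    R.lift f hf (R.tmul M u m) = f u m :=
  TensorProduct.lift.tmul u m

/-- Left multiplication by `s(a)` on `U ⊗_A M`. -/
def tensAct (M : LeftMod k A) (a : A) : R.Tens M →ₗ[k] R.Tens M :=
  R.lift ((R.tmul M).comp (LinearMap.mulLeft k (R.s a))) (by
    intro b u m
    simp only [LinearMap.comp_apply, LinearMap.mulLeft_apply]
    rw [← mul_assoc, R.s_t_comm, mul_assoc, tmul_act])

@[simp] lemma tensAct_tmul (M : LeftMod k A) (a : A) (u : U) (m : M) :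
    R.tensAct M a (R.tmul M u m) = R.tmul M (R.s a * u) m := by
  simp [tensAct]

/-- The action `a · (u ⊗ m) = s(a) u ⊗ m` of `A` on `U ⊗_A M`. -/
def tensActHom (M : LeftMod k A) : A →ₐ[k] Module.End k (R.Tens M) :=
  AlgHom.ofLinearMap
    { toFun := R.tensAct M
      map_add' := fun a b => R.tensor_ext fun u m => by simp [add_mul]
      map_smul' := fun c a => R.tensor_ext fun u m => by simp }
    (R.tensor_ext fun u m => by simp)
    (fun a b => R.tensor_ext fun u m => by simp [mul_assoc])

@[simp] lemma tensActHom_tmul (M : LeftMod k A) (a : A) (u : U) (m : M) :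
    R.tensActHom M a (R.tmul M u m) = R.tmul M (R.s a * u) m :=
  R.tensAct_tmul M a u m

/-- The left `A`-module `U ⊗_A M`. -/
@[reducible] def tens (M : LeftMod k A) : LeftMod k A where
  carrier := R.Tens M
  act := R.tensActHom M

/-- `id ⊗ f` as a `k`-linear map. -/
def mapLin {M N : LeftMod k A} (f : M.Hom N) : R.Tens M →ₗ[k] R.Tens N :=
  R.lift ((R.tmul N).compl₂ f.lin) (by intro a u m; simp [f.map_act, tmul_act])

@[simp] lemma mapLin_tmul {M N : LeftMod k A} (f : M.Hom N) (u : U) (m : M) :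
    R.mapLin f (R.tmul M u m) = R.tmul N u (f.lin m) := by
  simp [mapLin]

/-- `id ⊗ f : U ⊗_A M → U ⊗_A N`. -/
def map {M N : LeftMod k A} (f : M.Hom N) : (R.tens M).Hom (R.tens N) where
  lin := R.mapLin f
  map_act a := LinearMap.congr_fun (R.tensor_ext (M := M)
    (f := (R.mapLin f).comp ((R.tens M).act a))
    (g := ((R.tens N).act a).comp (R.mapLin f)) fun u m => by simp)

@[simp] lemma map_tmul {M N : LeftMod k A} (f : M.Hom N) (u : U) (m : M) :
    (R.map f).lin (R.tmul M u m) = R.tmul N u (f.lin m) :=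
  R.mapLin_tmul f u m

/-- `U` as a left `A`-module through the source map. -/
@[reducible] def self : LeftMod k A where
  carrier := U
  act := (Algebra.lmul k U).comp R.s

/-- `v ↦ v · a = t(a) v`, a left `A`-linear endomorphism of `U`. -/
def targetHom (a : A) : R.self.Hom R.self where
  lin := LinearMap.mulLeft k (R.t (op a))
  map_act b v := by
    change R.t (op a) * (R.s b * (v : U)) = R.s b * (R.t (op a) * (v : U))
    rw [← mul_assoc, ← R.s_t_comm, mul_assoc]

/-- `v ↦ v ⊗ m`, a left `A`-linear map `U → U ⊗_A M`. -/
def tmulHom (M : LeftMod k A) (m : M) : R.self.Hom (R.tens M) where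
  lin := (R.tmul M).flip m
  map_act a v := by
    change R.tmul M (R.s a * (v : U)) m = (R.tens M).act a (R.tmul M v m)
    simp

@[simp] lemma tmulHom_apply (M : LeftMod k A) (m : M) (v : U) :
    (R.tmulHom M m).lin v = R.tmul M v m := rfl

/-- Right multiplication `u ⊗ v ↦ u x ⊗ v y` on `U ⊗_A U`. -/
def rmulPure (x y : U) : R.Tens R.self →ₗ[k] R.Tens R.self :=
  R.lift (M := R.self)
    (LinearMap.mk₂ k (fun u (v : U) => R.tmul R.self (u * x) (v * y))
      (fun u u' v => by simp [add_mul]) (fun c u v => by simp)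
      (fun u v v' => by rw [add_mul]; simp) (fun c u v => by rw [smul_mul_assoc]; simp)) (by
    intro a u m
    change R.tmul R.self (R.t (op a) * u * x) ((m : U) * y) =
      R.tmul R.self (u * x) (R.s a * (m : U) * y)
    rw [mul_assoc, mul_assoc (R.s a)]
    exact R.tmul_act R.self a (u * x) ((m : U) * y))

@[simp] lemma rmulPure_tmul (x y u v : U) :
    R.rmulPure x y (R.tmul R.self u v) = R.tmul R.self (u * x) (v * y) :=
  R.lift_tmul (M := R.self) _ _ u v

/-- Right multiplication `(u ⊗ v) ↦ u x ⊗ v y` on `U ⊗_A U` by an element of `U ⊗_k U`. -/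
def rmul : (U ⊗[k] U) →ₗ[k] R.Tens R.self →ₗ[k] R.Tens R.self :=
  TensorProduct.lift (LinearMap.mk₂ k R.rmulPure
    (fun x x' y => R.tensor_ext fun u (m : U) => by
      rw [LinearMap.add_apply, rmulPure_tmul, rmulPure_tmul, rmulPure_tmul, mul_add, map_add,
        LinearMap.add_apply])
    (fun c x y => R.tensor_ext fun u (m : U) => by
      rw [LinearMap.smul_apply, rmulPure_tmul, rmulPure_tmul, mul_smul_comm, map_smul,
        LinearMap.smul_apply])
    (fun x y y' => R.tensor_ext fun u (m : U) => by
      rw [LinearMap.add_apply, rmulPure_tmul, rmulPure_tmul, rmulPure_tmul, mul_add, map_add])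
    (fun c x y => R.tensor_ext fun u (m : U) => by
      rw [LinearMap.smul_apply, rmulPure_tmul, rmulPure_tmul, mul_smul_comm, map_smul]))

@[simp] lemma rmul_tmul (x y u v : U) :
    R.rmul (x ⊗ₜ y) (R.tmul R.self u v) = R.tmul R.self (u * x) (v * y) :=
  R.rmulPure_tmul x y u v

end SourceTargetRing

/-- `U` with `A`-bilinear comultiplication `Δ : U → U ⊗_A U` and counit `ε : U → A`, for the bimodule
structure `a · u · b = s(a) t(b) u`. -/
structure BialgebroidData.{u, v} (k : Type v) (A U : Type u) [Field k] [Ring A] [Algebra k A]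
    [Ring U] [Algebra k U] extends SourceTargetRing k A U where
  /-- comultiplication -/
  Δ : U →ₗ[k] toSourceTargetRing.Tens toSourceTargetRing.self
  /-- counit -/
  ε : U →ₗ[k] A
  Δ_left : ∀ (a : A) (u : U),
    Δ (s a * u) = (toSourceTargetRing.tens toSourceTargetRing.self).act a (Δ u)
  Δ_right : ∀ (a : A) (u : U),
    Δ (t (op a) * u) = (toSourceTargetRing.map (toSourceTargetRing.targetHom a)).lin (Δ u)
  ε_left : ∀ (a : A) (u : U), ε (s a * u) = a * ε u
  ε_right : ∀ (a : A) (u : U), ε (t (op a) * u) = ε u * a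

namespace BialgebroidData

universe u v
variable {k : Type v} {A U : Type u} [Field k] [Ring A] [Algebra k A] [Ring U] [Algebra k U]
variable (B : BialgebroidData k A U)

/-- `Δ` as a left `A`-linear map. -/
def ΔHom : B.self.Hom (B.tens B.self) where
  lin := B.Δ
  map_act := B.Δ_left

lemma ΔTens_balanced (M : LeftMod k A) (a : A) (u : U) (m : M) :
    (B.map (B.tmulHom M m)).lin (B.Δ (B.t (op a) * u)) =
      (B.map (B.tmulHom M (M.act a m))).lin (B.Δ u) := by
  rw [B.Δ_right]
  refine LinearMap.congr_fun (B.tensor_ext (M := B.self)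
    (f := (B.map (B.tmulHom M m)).lin.comp (B.map (B.targetHom a)).lin)
    (g := (B.map (B.tmulHom M (M.act a m))).lin) fun p (q : U) => ?_) _
  simp only [LinearMap.comp_apply, B.map_tmul]
  exact congrArg _ (B.tmul_act M a q m)

/-- `Δ ⊗ id` as a `k`-linear map. -/
def ΔTensLin (M : LeftMod k A) : B.Tens M →ₗ[k] B.Tens (B.tens M) :=
  B.lift (LinearMap.mk₂ k (fun u m => (B.map (B.tmulHom M m)).lin (B.Δ u))
      (fun u u' m => by simp)
      (fun c u m => by simp)
      (fun u m m' => LinearMap.congr_fun (B.tensor_ext (M := B.self)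
        (f := (B.map (B.tmulHom M (m + m'))).lin)
        (g := (B.map (B.tmulHom M m)).lin + (B.map (B.tmulHom M m')).lin) fun p q => by
          rw [LinearMap.add_apply]; simp only [B.map_tmul, B.tmulHom_apply, map_add]) _)
      (fun c u m => LinearMap.congr_fun (B.tensor_ext (M := B.self)
        (f := (B.map (B.tmulHom M (c • m))).lin)
        (g := c • (B.map (B.tmulHom M m)).lin) fun p q => by
          rw [LinearMap.smul_apply]; simp only [B.map_tmul, B.tmulHom_apply, map_smul]) _))
    (B.ΔTens_balanced M)

@[simp] lemma ΔTensLin_tmul (M : LeftMod k A) (u : U) (m : M) :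
    B.ΔTensLin M (B.tmul M u m) = (B.map (B.tmulHom M m)).lin (B.Δ u) :=
  B.lift_tmul (M := M) _ _ u m

/-- `Δ ⊗ id : U ⊗_A M → U ⊗_A (U ⊗_A M)`, `u ⊗ m ↦ u₁ ⊗ (u₂ ⊗ m)`. -/
def ΔTens (M : LeftMod k A) : (B.tens M).Hom (B.tens (B.tens M)) where
  lin := B.ΔTensLin M
  map_act a := LinearMap.congr_fun (B.tensor_ext (M := M)
      (f := (B.ΔTensLin M).comp ((B.tens M).act a))
      (g := ((B.tens (B.tens M)).act a).comp (B.ΔTensLin M)) fun u m => by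
        simp only [LinearMap.comp_apply, B.tensActHom_tmul, ΔTensLin_tmul, B.Δ_left]
        exact (B.map (B.tmulHom M m)).map_act a (B.Δ u))

@[simp] lemma ΔTens_tmul (M : LeftMod k A) (u : U) (m : M) :
    (B.ΔTens M).lin (B.tmul M u m) = (B.map (B.tmulHom M m)).lin (B.Δ u) :=
  B.ΔTensLin_tmul M u m

/-- `ε ⊗ id` as a `k`-linear map. -/
def εTensLin (M : LeftMod k A) : B.Tens M →ₗ[k] M :=
  B.lift (M.act.toLinearMap.comp B.ε) (by intro a u m; simp [B.ε_right])

@[simp] lemma εTensLin_tmul (M : LeftMod k A) (u : U) (m : M) :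
    B.εTensLin M (B.tmul M u m) = M.act (B.ε u) m :=
  B.lift_tmul (M := M) (N := M) _ _ u m

/-- `ε ⊗ id : U ⊗_A M → M`, `u ⊗ m ↦ ε(u) · m`. -/
def εTens (M : LeftMod k A) : (B.tens M).Hom M where
  lin := B.εTensLin M
  map_act a := LinearMap.congr_fun (B.tensor_ext (M := M)
      (f := (B.εTensLin M).comp ((B.tens M).act a))
      (g := (M.act a).comp (B.εTensLin M)) fun u m => by simp [B.ε_left])

@[simp] lemma εTens_tmul (M : LeftMod k A) (u : U) (m : M) :
    (B.εTens M).lin (B.tmul M u m) = M.act (B.ε u) m :=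
  B.εTensLin_tmul M u m

/-- `id ⊗ ε : U ⊗_A U → U`, `u ⊗ v ↦ u · ε(v) = t(ε(v)) u`. -/
def tensε : B.Tens B.self →ₗ[k] U :=
  B.lift (M := B.self) (LinearMap.mk₂ k (fun u (v : U) => B.t (op (B.ε v)) * u)
    (fun u u' v => by simp [mul_add]) (fun c u v => by simp)
    (fun u v v' => by simp [add_mul]) (fun c u v => by simp)) (by
    intro a u v
    change B.t (op (B.ε v)) * (B.t (op a) * u) = B.t (op (B.ε (B.s a * (v : U)))) * u
    rw [B.ε_left, op_mul, map_mul, mul_assoc])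

@[simp] lemma tensε_tmul (u v : U) : B.tensε (B.tmul B.self u v) = B.t (op (B.ε v)) * u :=
  B.lift_tmul (M := B.self) _ _ u v

end BialgebroidData

/-- A left bialgebroid `(U, A, s, t, Δ, ε)`. -/
structure LeftBialgebroid.{u, v} (k : Type v) (A U : Type u) [Field k] [Ring A] [Algebra k A]
    [Ring U] [Algebra k U] extends BialgebroidData k A U where
  coassoc : ∀ u, (toBialgebroidData.ΔTens toBialgebroidData.self).lin (Δ u) =
    (toBialgebroidData.map toBialgebroidData.ΔHom).lin (Δ u)
  counit_left : ∀ u, (toBialgebroidData.εTens toBialgebroidData.self).lin (Δ u) = u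
  counit_right : ∀ u, toBialgebroidData.tensε (Δ u) = u
  /-- `Δ` takes values in the Takeuchi product: `u₁ t(a) ⊗ u₂ = u₁ ⊗ u₂ s(a)`. -/
  takeuchi : ∀ (a : A) (u : U),
    toBialgebroidData.rmul (t (op a) ⊗ₜ[k] 1) (Δ u) = toBialgebroidData.rmul (1 ⊗ₜ[k] s a) (Δ u)
  Δ_one : Δ 1 = toBialgebroidData.tmul toBialgebroidData.self 1 (1 : U)
  /-- `Δ(uv) = u₁ v₁ ⊗ u₂ v₂`, where `q` is any representative `∑ v₁ ⊗_k v₂` of `Δ(v)`. -/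
  Δ_mul : ∀ (u v : U) (q : U ⊗[k] U), toBialgebroidData.proj toBialgebroidData.self q = Δ v →
    Δ (u * v) = toBialgebroidData.rmul q (Δ u)
  ε_one : ε 1 = 1
  ε_mul_s : ∀ u v, ε (u * s (ε v)) = ε (u * v)
  ε_mul_t : ∀ u v, ε (u * t (op (ε v))) = ε (u * v)

/-- A Hopf algebroid with involutive antipode `S`. -/
structure HopfAlgebroid.{u, v} (k : Type v) (A U : Type u) [Field k] [Ring A] [Algebra k A]
    [Ring U] [Algebra k U] extends LeftBialgebroid k A U where
  /-- antipode -/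
  S : U →ₗ[k] U
  S_one : S 1 = 1
  S_mul : ∀ u v, S (u * v) = S v * S u
  S_S : ∀ u, S (S u) = u
  S_t : ∀ a, S (t (op a)) = s a
  /-- `S(u₁)₁ u₂ ⊗ S(u₁)₂ = 1 ⊗ S(u)`, where `p` is any representative `∑ u₁ ⊗_k u₂` of `Δ(u)`. -/
  antipode_left : ∀ (u : U) (p : U ⊗[k] U), toBialgebroidData.proj toBialgebroidData.self p = Δ u →
    TensorProduct.lift (LinearMap.mk₂ k
      (fun x y => toBialgebroidData.rmul (y ⊗ₜ[k] 1) (Δ (S x)))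
      (by simp) (by simp) (by simp [TensorProduct.add_tmul])
      (by simp [← TensorProduct.smul_tmul'])) p
    = toBialgebroidData.tmul toBialgebroidData.self 1 (S u)
  /-- `S(u₂)₁ ⊗ S(u₂)₂ u₁ = S(u) ⊗ 1`, where `p` is any representative `∑ u₁ ⊗_k u₂` of `Δ(u)`. -/
  antipode_right : ∀ (u : U) (p : U ⊗[k] U), toBialgebroidData.proj toBialgebroidData.self p = Δ u →
    TensorProduct.lift (LinearMap.mk₂ k
      (fun x y => toBialgebroidData.rmul (1 ⊗ₜ[k] x) (Δ (S y)))
      (by simp [TensorProduct.tmul_add]) (by simp) (by simp) (by simp)) p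
    = toBialgebroidData.tmul toBialgebroidData.self (S u) (1 : U)

/-! ### The diagonal action of `U` on tensor products -/

/-- A left `U`-module structure on a left `A`-module `M`, extending the action of `A` along `s`. -/
structure LeftBialgebroid.Act.{u, v} {k : Type v} {A U : Type u} [Field k] [Ring A] [Algebra k A]
    [Ring U] [Algebra k U] (B : LeftBialgebroid k A U) (M : LeftMod k A) where
  /-- the action of `U` -/
  ρ : U →ₐ[k] Module.End k M
  ρ_s : ∀ a, ρ (B.s a) = M.act a

namespace LeftBialgebroid

universe u v
variable {k : Type v} {A U : Type u} [Field k] [Ring A] [Algebra k A] [Ring U] [Algebra k U]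
variable (B : LeftBialgebroid k A U)

variable {B} in
/-- For `z = ∑ x ⊗ y` in `U ⊗_A U`, the bilinear map `(u, m) ↦ ∑ x u ⊗ y m`. -/
def Act.mulK {M : LeftMod k A} (P : B.Act M) : B.Tens B.self →ₗ[k] U →ₗ[k] M →ₗ[k] B.Tens M :=
  B.lift (M := B.self) (LinearMap.mk₂ k
    (fun p (q : U) => (B.tmul M).compl₁₂ (LinearMap.mulLeft k p) (P.ρ q))
    (fun p p' q => by ext u m; simp [add_mul])
    (fun c p q => by ext u m; simp)
    (fun p q q' => by ext u m; simp only [LinearMap.compl₁₂_apply, LinearMap.add_apply]; rw [map_add]; simp)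
    (fun c p q => by ext u m; simp only [LinearMap.compl₁₂_apply, LinearMap.smul_apply]; rw [map_smul]; simp)) (by
    intro a p q
    ext u m
    change B.tmul M (B.t (op a) * p * u) (P.ρ (q : U) m) = B.tmul M (p * u) (P.ρ (B.s a * (q : U)) m)
    rw [mul_assoc, B.tmul_act, map_mul P.ρ, P.ρ_s]; rfl)

variable {B} in
lemma Act.mulK_tmul {M : LeftMod k A} (P : B.Act M) (p q u : U) (m : M) :
    P.mulK (B.tmul B.self p q) u m = B.tmul M (p * u) (P.ρ q m) :=
  LinearMap.congr_fun (LinearMap.congr_fun (B.lift_tmul (M := B.self) _ _ p q) u) m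

variable {B} in
lemma Act.mulK_rmul {M : LeftMod k A} (P : B.Act M) (z : B.Tens B.self) (x y u : U) (m : M) :
    P.mulK (B.rmul (x ⊗ₜ y) z) u m = P.mulK z (x * u) (P.ρ y m) := by
  refine LinearMap.congr_fun (B.tensor_ext (M := B.self)
    (f := ((P.mulK.flip u).flip m).comp (B.rmul (x ⊗ₜ y)))
    (g := ((P.mulK.flip (x * u)).flip (P.ρ y m))) fun p (q : U) => ?_) z
  simp only [LinearMap.comp_apply, LinearMap.flip_apply]
  rw [B.rmul_tmul, P.mulK_tmul, P.mulK_tmul, map_mul P.ρ, mul_assoc]; rfl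

variable {B} in
lemma Act.mulK_Δ_balanced {M : LeftMod k A} (P : B.Act M) (h : U) (a : A) (u : U) (m : M) :
    P.mulK (B.Δ h) (B.t (op a) * u) m = P.mulK (B.Δ h) u (M.act a m) := by
  have h1 := P.mulK_rmul (B.Δ h) (B.t (op a)) 1 u m
  have h2 := P.mulK_rmul (B.Δ h) 1 (B.s a) u m
  rw [B.takeuchi, h2] at h1
  rw [one_mul, map_one, P.ρ_s] at h1
  exact h1.symm

variable {B} in
/-- The diagonal action `h · (u ⊗ m) = h₁ u ⊗ h₂ m` on `U ⊗_A M`. -/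
def Act.diag {M : LeftMod k A} (P : B.Act M) (h : U) : B.Tens M →ₗ[k] B.Tens M :=
  B.lift (P.mulK (B.Δ h)) (P.mulK_Δ_balanced h)

variable {B} in
@[simp] lemma Act.diag_tmul {M : LeftMod k A} (P : B.Act M) (h u : U) (m : M) :
    P.diag h (B.tmul M u m) = P.mulK (B.Δ h) u m := by
  simp [diag]

variable {B} in
lemma Act.diag_mulK_proj {M : LeftMod k A} (P : B.Act M) (g u : U) (m : M) (q : U ⊗[k] U) :
    P.diag g (P.mulK (B.proj B.self q) u m) = P.mulK (B.rmul q (B.Δ g)) u m := by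
  induction q using TensorProduct.induction_on with
  | zero => simp
  | tmul x y =>
    rw [P.mulK_rmul]; erw [B.proj_tmul B.self x y]
    rw [P.mulK_tmul, P.diag_tmul]
  | add q q' h h' => simp only [map_add, LinearMap.add_apply, h, h']

variable {B} in
/-- The diagonal action of `U` on `U ⊗_A M`. -/
def Act.tens {M : LeftMod k A} (P : B.Act M) : B.Act (B.tens M) where
  ρ := AlgHom.ofLinearMap
    { toFun := P.diag
      map_add' := fun g h => B.tensor_ext fun u m => by
        rw [LinearMap.add_apply]; simp
      map_smul' := fun c g => B.tensor_ext fun u m => by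
        rw [LinearMap.smul_apply]; simp }
    (B.tensor_ext fun u m => by
      change P.diag 1 (B.tmul M u m) = B.tmul M u m
      rw [P.diag_tmul, B.Δ_one, P.mulK_tmul, one_mul, map_one]; rfl)
    (fun g h => B.tensor_ext fun u m => by
      change P.diag (g * h) (B.tmul M u m) = P.diag g (P.diag h (B.tmul M u m))
      obtain ⟨q, hq⟩ := B.proj_surjective B.self (B.Δ h)
      rw [P.diag_tmul, P.diag_tmul, B.Δ_mul g h q hq, ← hq, P.diag_mulK_proj])
  ρ_s a := B.tensor_ext fun u m => by
    change P.diag (B.s a) (B.tmul M u m) = B.tensActHom M a (B.tmul M u m)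
    rw [P.diag_tmul, B.tensActHom_tmul, ← mul_one (B.s a), B.Δ_left, B.Δ_one]
    rw [B.tensActHom_tmul, P.mulK_tmul, map_one]; rfl

variable {B} in
@[simp] lemma Act.tens_tmul {M : LeftMod k A} (P : B.Act M) (h u : U) (m : M) :
    P.tens.ρ h (B.tmul M u m) = P.mulK (B.Δ h) u m :=
  P.diag_tmul h u m

/-- The action `h · a = ε(h s(a))` of `U` on `A`. -/
def unitAct : B.Act (LeftMod.unit k A) where
  ρ := AlgHom.ofLinearMap
    { toFun := fun h => B.ε.comp ((LinearMap.mulLeft k h).comp B.s.toLinearMap)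
      map_add' := fun g h => by ext a; simp [add_mul]
      map_smul' := fun c h => by ext a; simp }
    (by
      ext a
      change B.ε (1 * B.s a) = a
      rw [one_mul, ← mul_one (B.s a), B.ε_left, B.ε_one, mul_one])
    (fun g h => by
      ext a
      change B.ε (g * h * B.s a) = B.ε (g * B.s (B.ε (h * B.s a)))
      rw [B.ε_mul_s, mul_assoc])
  ρ_s a := by
    ext b
    change B.ε (B.s a * B.s b) = a * b
    rw [← map_mul, ← mul_one (B.s _), B.ε_left, B.ε_one, mul_one]

lemma unitAct_apply (h : U) (a : A) : B.unitAct.ρ h a = B.ε (h * B.s a) := rfl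

end LeftBialgebroid

/-! ### The cochain spaces and their structure maps -/

namespace SourceTargetRing

universe u v
variable {k : Type v} {A U : Type u} [Field k] [Ring A] [Algebra k A] [Ring U] [Algebra k U]

/-- `Cⁿ(U) = U ⊗_A ⋯ ⊗_A U` (`n` factors), realised as `U ⊗_A (U ⊗_A (⋯ (U ⊗_A A)))`; in particular
`C⁰(U) = A`. The element `u¹ ⊗ ⋯ ⊗ uⁿ` is `u¹ ⊗ (u² ⊗ (⋯ (uⁿ ⊗ 1)))`. -/
def cochain (R : SourceTargetRing k A U) : ℕ → LeftMod k A
  | 0 => LeftMod.unit k A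
  | n + 1 => R.tens (R.cochain n)

variable (R : SourceTargetRing k A U)

/-- The identification of `A` with `C⁰(U)`. -/
def base : A →ₗ[k] R.cochain 0 := LinearMap.id

lemma exists_base (x : R.cochain 0) : ∃ a, x = R.base a := ⟨x, rfl⟩

lemma act_base (a b : A) : (R.cochain 0).act a (R.base b) = R.base (a * b) := rfl

/-- `(u, w) ↦ u ⊗ w` from `U × Cⁿ(U)` to `Cⁿ⁺¹(U)`. -/
def cons (n : ℕ) : U →ₗ[k] R.cochain n →ₗ[k] R.cochain (n + 1) := R.tmul (R.cochain n)

lemma cons_act (n : ℕ) (a : A) (u : U) (w : R.cochain n) :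
    R.cons n (R.t (op a) * u) w = R.cons n u ((R.cochain n).act a w) :=
  R.tmul_act _ a u w

lemma act_cons (n : ℕ) (a : A) (u : U) (w : R.cochain n) :
    (R.cochain (n + 1)).act a (R.cons n u w) = R.cons n (R.s a * u) w :=
  R.tensAct_tmul _ a u w

lemma cochain_ext {n : ℕ} {N : Type*} [AddCommGroup N] [Module k N]
    (f g : R.cochain (n + 1) →ₗ[k] N) (h : ∀ u w, f (R.cons n u w) = g (R.cons n u w)) : f = g :=
  R.tensor_ext (M := R.cochain n) h

lemma cochain_induction {n : ℕ} {P : R.cochain (n + 1) → Prop} (h : ∀ u w, P (R.cons n u w))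
    (hadd : ∀ x y, P x → P y → P (x + y)) (x : R.cochain (n + 1)) : P x := by
  obtain ⟨p, hp⟩ := R.proj_surjective (R.cochain n) x
  rw [← hp]
  clear hp
  induction p using TensorProduct.induction_on with
  | zero =>
    have h0 := h 0 0
    rw [map_zero] at h0
    rw [map_zero]
    exact h0
  | tmul u w => exact h u w
  | add p q hp hq =>
    rw [map_add]
    exact hadd _ _ hp hq

/-- Linear maps out of `Cⁿ⁺¹(U) = U ⊗_A Cⁿ(U)`. -/
def cochainLift {n : ℕ} {N : Type*} [AddCommGroup N] [Module k N]
    (f : U →ₗ[k] R.cochain n →ₗ[k] N)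
    (hf : ∀ a u w, f (R.t (op a) * u) w = f u ((R.cochain n).act a w)) :
    R.cochain (n + 1) →ₗ[k] N :=
  R.lift f hf

lemma cochainLift_cons {n : ℕ} {N : Type*} [AddCommGroup N] [Module k N]
    (f : U →ₗ[k] R.cochain n →ₗ[k] N) (hf) (u : U) (w : R.cochain n) :
    R.cochainLift f hf (R.cons n u w) = f u w :=
  R.lift_tmul f hf u w

/-- The bilinear map `(u, a) ↦ u · a = t(a) u`. -/
def rightAct : U →ₗ[k] R.cochain 0 →ₗ[k] U :=
  ((LinearMap.mul k U).comp (R.t.toLinearMap.comp (opLinearEquiv k).toLinearMap)).flip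

lemma rightAct_apply (u : U) (a : A) : R.rightAct u (R.base a) = R.t (op a) * u := rfl

/-- `C¹(U) = U ⊗_A A` is canonically `U`. -/
def cochainOneEquiv : R.cochain 1 ≃ₗ[k] U :=
  LinearEquiv.ofLinearMap
    (R.cochainLift (n := 0) R.rightAct (by
      intro a u w
      obtain ⟨b, hb⟩ := R.exists_base w
      rw [hb]
      change R.t (op b) * (R.t (op a) * u) = R.t (op (a * b)) * u
      rw [op_mul, map_mul, mul_assoc]))
    ((R.cons 0).flip (R.base 1))
    (by
      ext u
      rw [LinearMap.comp_apply, LinearMap.flip_apply, R.cochainLift_cons]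
      change R.t (op 1) * u = u
      rw [op_one, map_one, one_mul])
    (R.cochain_ext _ _ fun u w => by
      rw [LinearMap.comp_apply, R.cochainLift_cons, LinearMap.flip_apply, LinearMap.id_apply]
      obtain ⟨a, ha⟩ := R.exists_base w
      rw [ha]
      change R.cons 0 (R.t (op a) * u) (R.base 1) = _
      rw [R.cons_act, R.act_base, mul_one])

/-- `u¹ ⊗ ⋯ ⊗ uⁿ`, for `uⁱ⁺¹ = F i`. -/
def pure : (n : ℕ) → (ℕ → U) → R.cochain n
  | 0, _ => R.base 1
  | n + 1, F => R.cons n (F 0) (pure n fun i => F (i + 1))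

/-- `a ↦ s(a) g ⊗ 1` from `C⁰(U) = A` to `C¹(U)`. -/
def snocZero (g : U) : (LeftMod.unit k A).Hom (R.tens (LeftMod.unit k A)) where
  lin := ((R.tmul (LeftMod.unit k A)).flip (1 : A)).comp
    ((LinearMap.mulRight k g).comp R.s.toLinearMap)
  map_act a b := by
    change R.tmul _ (R.s (a * (b : A)) * g) _ = R.tensActHom _ a (R.tmul _ (R.s b * g) _)
    rw [R.tensActHom_tmul, map_mul R.s, mul_assoc]

lemma snocZero_apply (g : U) (a : A) :
    (R.snocZero g).lin a = R.tmul (LeftMod.unit k A) (R.s a * g) (1 : A) := rfl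

/-- `u¹ ⊗ ⋯ ⊗ uⁿ ↦ u¹ ⊗ ⋯ ⊗ uⁿ ⊗ g`. -/
def snoc (g : U) : (n : ℕ) → (R.cochain n).Hom (R.cochain (n + 1))
  | 0 => R.snocZero g
  | n + 1 => R.map (snoc g n)

lemma snoc_base (g : U) (a : A) :
    (R.snoc g 0).lin (R.base a) = R.cons 0 (R.s a * g) (R.base 1) := rfl

lemma snoc_cons (g : U) (n : ℕ) (u : U) (w : R.cochain n) :
    (R.snoc g (n + 1)).lin (R.cons n u w) = R.cons (n + 1) u ((R.snoc g n).lin w) :=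
  R.mapLin_tmul (R.snoc g n) u w

end SourceTargetRing

namespace BialgebroidData

universe u v
variable {k : Type v} {A U : Type u} [Field k] [Ring A] [Algebra k A] [Ring U] [Algebra k U]
variable (B : BialgebroidData k A U)

/-- The coface `δ_{i+1} : Cⁿ(U) → Cⁿ⁺¹(U)` for `i ≤ n`: it applies `Δ` to the factor `uⁱ⁺¹` if `i < n`,
and is `u¹ ⊗ ⋯ ⊗ uⁿ ↦ u¹ ⊗ ⋯ ⊗ uⁿ ⊗ 1` if `i = n` (`a ↦ s(a)` if `n = 0`). -/
def cofaceSucc : (n i : ℕ) → (B.cochain n).Hom (B.cochain (n + 1))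
  | 0, _ => B.snoc 1 0
  | n + 1, 0 => B.ΔTens (B.cochain n)
  | n + 1, i + 1 => B.map (cofaceSucc n i)

/-- The cofaces `δ_i : Cⁿ(U) → Cⁿ⁺¹(U)`, `0 ≤ i ≤ n + 1`; `δ_0 w = 1 ⊗ w`. -/
def coface (n : ℕ) : ℕ → (B.cochain n →ₗ[k] B.cochain (n + 1))
  | 0 => B.tmul (B.cochain n) 1
  | i + 1 => (B.cofaceSucc n i).lin

/-- `p ⊗ q ↦ p ⊗ q ⊗ w` from `U ⊗_A U` to `Cⁿ⁺²(U)`, for `w` in `Cⁿ(U)`. -/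
def consTwo (n : ℕ) (w : B.cochain n) : B.Tens B.self →ₗ[k] B.cochain (n + 1 + 1) :=
  (B.map (B.tmulHom (B.cochain n) w)).lin

lemma consTwo_tmul (n : ℕ) (w : B.cochain n) (p q : U) :
    B.consTwo n w (B.tmul B.self p q) = B.cons (n + 1) p (B.cons n q w) :=
  B.map_tmul _ _ _

lemma coface_zero (n : ℕ) (w : B.cochain n) : B.coface n 0 w = B.cons n 1 w := rfl

lemma coface_one (n : ℕ) (u : U) (w : B.cochain n) :
    B.coface (n + 1) 1 (B.cons n u w) = B.consTwo n w (B.Δ u) :=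
  B.ΔTens_tmul _ u w

lemma coface_succ_succ (n i : ℕ) (u : U) (w : B.cochain n) :
    B.coface (n + 1) (i + 1 + 1) (B.cons n u w) = B.cons (n + 1) u (B.coface n (i + 1) w) :=
  B.map_tmul (B.cofaceSucc n i) u w

lemma coface_base (i : ℕ) (a : A) :
    B.coface 0 (i + 1) (B.base a) = B.cons 0 (B.s a) (B.base 1) := by
  change B.cons 0 (B.s a * 1) (B.base 1) = _
  rw [mul_one]

lemma coface_act (n i : ℕ) (a : A) (w : B.cochain n) :
    B.coface n (i + 1) ((B.cochain n).act a w) = (B.cochain (n + 1)).act a (B.coface n (i + 1) w) :=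
  (B.cofaceSucc n i).map_act a w

lemma cofaceSucc_self : ∀ n, B.cofaceSucc n n = B.snoc 1 n
  | 0 => rfl
  | n + 1 => congrArg B.map (cofaceSucc_self n)

lemma coface_last (n : ℕ) (w : B.cochain n) : B.coface n (n + 1) w = (B.snoc 1 n).lin w :=
  congrArg (fun f => LeftMod.Hom.lin f w) (B.cofaceSucc_self n)

/-- The codegeneracies `σ_i : Cⁿ⁺¹(U) → Cⁿ(U)`, `0 ≤ i ≤ n`, applying `ε` to the factor `uⁱ⁺¹`. -/
def codegHom : (n i : ℕ) → (B.cochain (n + 1)).Hom (B.cochain n)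
  | n, 0 => B.εTens (B.cochain n)
  | 0, _ + 1 => B.εTens (B.cochain 0)
  | n + 1, i + 1 => B.map (codegHom n i)

/-- The codegeneracies as `k`-linear maps. -/
def codeg (n i : ℕ) : B.cochain (n + 1) →ₗ[k] B.cochain n := (B.codegHom n i).lin

lemma codeg_zero (n : ℕ) (u : U) (w : B.cochain n) :
    B.codeg n 0 (B.cons n u w) = (B.cochain n).act (B.ε u) w := by
  unfold codeg codegHom
  cases n <;> exact B.εTens_tmul _ u w

lemma codeg_succ (n i : ℕ) (u : U) (w : B.cochain (n + 1)) :
    B.codeg (n + 1) (i + 1) (B.cons (n + 1) u w) = B.cons n u (B.codeg n i w) :=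
  B.map_tmul (B.codegHom n i) u w

lemma codeg_act (n i : ℕ) (a : A) (w : B.cochain (n + 1)) :
    B.codeg n i ((B.cochain (n + 1)).act a w) = (B.cochain n).act a (B.codeg n i w) :=
  (B.codegHom n i).map_act a w

end BialgebroidData

namespace LeftBialgebroid

universe u v
variable {k : Type v} {A U : Type u} [Field k] [Ring A] [Algebra k A] [Ring U] [Algebra k U]
variable (B : LeftBialgebroid k A U)

/-- The diagonal action of `U` on `Cⁿ(U)`:
`h · (u¹ ⊗ ⋯ ⊗ uⁿ) = h₁ u¹ ⊗ ⋯ ⊗ hₙ uⁿ`, and `h · a = ε(h s(a))` on `C⁰(U) = A`. -/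
def cochainAct : (n : ℕ) → B.Act (B.cochain n)
  | 0 => B.unitAct
  | n + 1 => (cochainAct n).tens

/-- For `z = ∑ x ⊗ y` in `U ⊗_A U`, the bilinear map `(u, w) ↦ ∑ x u ⊗ y w`. -/
def mulC (n : ℕ) : B.Tens B.self →ₗ[k] U →ₗ[k] B.cochain n →ₗ[k] B.cochain (n + 1) :=
  (B.cochainAct n).mulK

lemma mulC_tmul (n : ℕ) (p q u : U) (w : B.cochain n) :
    B.mulC n (B.tmul B.self p q) u w = B.cons n (p * u) ((B.cochainAct n).ρ q w) :=
  (B.cochainAct n).mulK_tmul p q u w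

lemma mulC_rmul (n : ℕ) (z : B.Tens B.self) (x y u : U) (w : B.cochain n) :
    B.mulC n (B.rmul (x ⊗ₜ y) z) u w = B.mulC n z (x * u) ((B.cochainAct n).ρ y w) :=
  (B.cochainAct n).mulK_rmul z x y u w

lemma act_cons' (n : ℕ) (h u : U) (w : B.cochain n) :
    (B.cochainAct (n + 1)).ρ h (B.cons n u w) = B.mulC n (B.Δ h) u w :=
  (B.cochainAct n).tens_tmul h u w

lemma act_base' (h : U) (a : A) :
    (B.cochainAct 0).ρ h (B.base a) = B.base (B.ε (h * B.s a)) := rfl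

end LeftBialgebroid

namespace HopfAlgebroid

universe u v
variable {k : Type v} {A U : Type u} [Field k] [Ring A] [Algebra k A] [Ring U] [Algebra k U]
variable (H : HopfAlgebroid k A U)

lemma S_t_mul (a : A) (u : U) : H.S (H.t (op a) * u) = H.S u * H.s a := by
  rw [H.S_mul, H.S_t]

/-- The cocyclic operator `τₙ`, with
`τₙ(u¹ ⊗ ⋯ ⊗ uⁿ) = S(u¹)₁ u² ⊗ ⋯ ⊗ S(u¹)ₙ₋₁ uⁿ ⊗ S(u¹)ₙ = S(u¹) · (u² ⊗ ⋯ ⊗ uⁿ ⊗ 1)` for the diagonal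
action, and `τ₀ = id`. -/
def cyc : (n : ℕ) → (H.cochain n →ₗ[k] H.cochain n)
  | 0 => LinearMap.id
  | n + 1 => H.cochainLift
      (((H.cochainAct (n + 1)).ρ.toLinearMap.comp H.S).compl₂ (H.snoc 1 n).lin) (by
      intro a u m
      change (H.cochainAct (n + 1)).ρ (H.S (H.t (op a) * u)) ((H.snoc 1 n).lin m) =
        (H.cochainAct (n + 1)).ρ (H.S u) ((H.snoc 1 n).lin ((H.cochain n).act a m))
      rw [H.S_t_mul, map_mul, (H.cochainAct (n + 1)).ρ_s, (H.snoc 1 n).map_act]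
      rfl)

lemma cyc_cons (n : ℕ) (u : U) (w : H.cochain n) :
    H.cyc (n + 1) (H.cons n u w) =
      (H.cochainAct (n + 1)).ρ (H.S u) ((H.snoc 1 n).lin w) := by
  unfold cyc
  exact H.cochainLift_cons _ _ u w

end HopfAlgebroid

/-! ### Cocyclic modules -/

/-- A cocyclic `k`-module: cofaces `δ n i : Xⁿ → Xⁿ⁺¹` for `0 ≤ i ≤ n + 1`, codegeneracies
`σ n i : Xⁿ⁺¹ → Xⁿ` for `0 ≤ i ≤ n` and cocyclic operators `τ n : Xⁿ → Xⁿ`. The values of `δ n i` and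
`σ n i` for other indices `i` carry no meaning and are not used. -/
structure CocyclicModule.{u, v} (k : Type v) [Field k] where
  /-- the spaces of cochains -/
  X : ℕ → Type u
  [grp : ∀ n, AddCommGroup (X n)]
  [mod : ∀ n, Module k (X n)]
  /-- cofaces -/
  δ : ∀ n : ℕ, ℕ → (X n →ₗ[k] X (n + 1))
  /-- codegeneracies -/
  σ : ∀ n : ℕ, ℕ → (X (n + 1) →ₗ[k] X n)
  /-- cocyclic operators -/
  τ : ∀ n : ℕ, X n →ₗ[k] X n
  δ_δ : ∀ n i j, i ≤ j → j ≤ n + 1 → ∀ x, δ (n + 1) (j + 1) (δ n i x) = δ (n + 1) i (δ n j x)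
  σ_σ : ∀ n i j, i ≤ j → j ≤ n → ∀ x, σ n j (σ (n + 1) i x) = σ n i (σ (n + 1) (j + 1) x)
  σ_δ_of_le : ∀ n i j, i ≤ j → j ≤ n → ∀ x, σ (n + 1) (j + 1) (δ (n + 1) i x) = δ n i (σ n j x)
  σ_δ_self : ∀ n j, j ≤ n → ∀ x, σ n j (δ n j x) = x
  σ_δ_succ : ∀ n j, j ≤ n → ∀ x, σ n j (δ n (j + 1) x) = x
  σ_δ_of_lt : ∀ n i j, j < i → i ≤ n + 1 → ∀ x, σ (n + 1) j (δ (n + 1) (i + 1) x) = δ n i (σ n j x)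
  τ_δ_zero : ∀ n x, τ (n + 1) (δ n 0 x) = δ n (n + 1) x
  τ_δ_succ : ∀ n i, i ≤ n → ∀ x, τ (n + 1) (δ n (i + 1) x) = δ n i (τ n x)
  τ_σ_zero : ∀ n x, τ n (σ n 0 x) = σ n n (τ (n + 1) (τ (n + 1) x))
  τ_σ_succ : ∀ n i, i + 1 ≤ n → ∀ x, τ n (σ n (i + 1) x) = σ n i (τ (n + 1) x)
  τ_pow : ∀ n, τ n ^ (n + 1) = 1

/-! ### The cocyclic module of a Hopf algebroid -/

attribute [ext] LeftMod.Hom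

namespace BialgebroidData

universe u v
variable {k : Type v} {A U : Type u} [Field k] [Ring A] [Algebra k A] [Ring U] [Algebra k U]
variable (B : BialgebroidData k A U)

lemma coface_consTwo (n i : ℕ) (w : B.cochain n) (z : B.Tens B.self) :
    B.coface (n + 1 + 1) (i + 1 + 1 + 1) (B.consTwo n w z) =
      B.consTwo (n + 1) (B.coface n (i + 1) w) z :=
  LinearMap.congr_fun (B.tensor_ext (M := B.self)
    (f := (B.coface (n + 1 + 1) (i + 1 + 1 + 1)).comp (B.consTwo n w))
    (g := B.consTwo (n + 1) (B.coface n (i + 1) w)) fun u v => by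
      rw [LinearMap.comp_apply, consTwo_tmul, consTwo_tmul, coface_succ_succ, coface_succ_succ]) z

lemma codeg_consTwo (n i : ℕ) (w : B.cochain (n + 1)) (z : B.Tens B.self) :
    B.codeg (n + 1 + 1) (i + 1 + 1) (B.consTwo (n + 1) w z) = B.consTwo n (B.codeg n i w) z :=
  LinearMap.congr_fun (B.tensor_ext (M := B.self)
    (f := (B.codeg (n + 1 + 1) (i + 1 + 1)).comp (B.consTwo (n + 1) w))
    (g := B.consTwo n (B.codeg n i w)) fun u v => by
      rw [LinearMap.comp_apply, consTwo_tmul, consTwo_tmul, codeg_succ, codeg_succ]) z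

end BialgebroidData

namespace LeftBialgebroid

universe u v
variable {k : Type v} {A U : Type u} [Field k] [Ring A] [Algebra k A] [Ring U] [Algebra k U]
variable (B : LeftBialgebroid k A U)

lemma consTwo_Δ_one (n : ℕ) (w : B.cochain n) :
    B.consTwo n w (B.Δ 1) = B.cons (n + 1) 1 (B.cons n 1 w) := by
  rw [B.Δ_one, B.consTwo_tmul]

lemma Δ_s (a : A) : B.Δ (B.s a) = B.tmul B.self (B.s a) (1 : U) := by
  rw [← mul_one (B.s a), B.Δ_left, B.Δ_one, B.tensActHom_tmul]

lemma Δ_t (a : A) : B.Δ (B.t (op a)) = B.tmul B.self 1 (B.t (op a)) := by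
  rw [← mul_one (B.t (op a)), B.Δ_right, B.Δ_one, B.map_tmul]
  rfl

lemma Δ_mul_s (h : U) (a : A) : B.Δ (h * B.s a) = B.rmul (B.s a ⊗ₜ 1) (B.Δ h) :=
  B.Δ_mul h _ _ (by rw [B.Δ_s]; rfl)

/-- `x ⊗ (y ⊗ z) ↦ x ⊗ y ⊗ z ⊗ w`. -/
def consThree (n : ℕ) (w : B.cochain n) : B.Tens (B.tens B.self) →ₗ[k] B.cochain (n + 1 + 1 + 1) :=
  (B.map (B.map (B.tmulHom (B.cochain n) w))).lin

lemma consThree_tmul (n : ℕ) (w : B.cochain n) (x : U) (z : B.Tens B.self) :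
    B.consThree n w (B.tmul (B.tens B.self) x z) = B.cons (n + 1 + 1) x (B.consTwo n w z) :=
  B.map_tmul _ _ _

lemma consThree_ΔTens (n : ℕ) (w : B.cochain n) (z : B.Tens B.self) :
    B.consThree n w ((B.ΔTens B.self).lin z) = B.coface (n + 1 + 1) 1 (B.consTwo n w z) :=
  LinearMap.congr_fun (B.tensor_ext (M := B.self)
    (f := (B.consThree n w).comp (B.ΔTens B.self).lin)
    (g := (B.coface (n + 1 + 1) 1).comp (B.consTwo n w)) fun p (q : U) => by
      rw [LinearMap.comp_apply, LinearMap.comp_apply, B.consTwo_tmul, B.coface_one, B.ΔTens_tmul]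
      exact LinearMap.congr_fun (B.tensor_ext (M := B.self)
        (f := (B.consThree n w).comp (B.map (B.tmulHom B.self q)).lin)
        (g := B.consTwo (n + 1) (B.cons n q w)) fun p' (q' : U) => by
          rw [LinearMap.comp_apply, B.map_tmul, B.consThree_tmul, B.consTwo_tmul]
          exact congrArg _ (B.consTwo_tmul n w q' q)) _) z

lemma consThree_map_Δ (n : ℕ) (w : B.cochain n) (z : B.Tens B.self) :
    B.consThree n w ((B.map B.ΔHom).lin z) = B.coface (n + 1 + 1) (1 + 1) (B.consTwo n w z) :=
  LinearMap.congr_fun (B.tensor_ext (M := B.self)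
    (f := (B.consThree n w).comp (B.map B.ΔHom).lin)
    (g := (B.coface (n + 1 + 1) (1 + 1)).comp (B.consTwo n w)) fun p (q : U) => by
      rw [LinearMap.comp_apply, LinearMap.comp_apply, B.consTwo_tmul, B.coface_succ_succ _ 0,
        B.coface_one, B.map_tmul, B.consThree_tmul]
      rfl) z

lemma coface_coface : ∀ n i j, i ≤ j → j ≤ n + 1 → ∀ x : B.cochain n,
    B.coface (n + 1) (j + 1) (B.coface n i x) = B.coface (n + 1) i (B.coface n j x) := by
  intro n
  induction n with
  | zero =>
    intro i j hij hj a
    rcases i with _ | i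
    · rcases j with _ | j
      · rw [B.coface_zero, B.coface_one, B.consTwo_Δ_one, B.coface_zero]
      · rw [B.coface_zero, B.coface_succ_succ, B.coface_zero]
    · obtain rfl : i = 0 := by omega
      obtain rfl : j = 1 := by omega
      obtain ⟨a, ha⟩ := B.exists_base a
      rw [ha, B.coface_base, B.coface_succ_succ 0 0, B.coface_base, B.coface_one,
        B.Δ_s, B.consTwo_tmul, map_one]
  | succ n ih =>
    intro i j hij hj x
    rcases i with _ | i
    · rcases j with _ | j
      · rw [B.coface_zero, B.coface_one, B.consTwo_Δ_one, B.coface_zero]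
      · rw [B.coface_zero, B.coface_succ_succ, B.coface_zero]
    · obtain ⟨j, rfl⟩ : ∃ j', j = j' + 1 := ⟨j - 1, by omega⟩
      refine LinearMap.congr_fun (B.cochain_ext
        ((B.coface (n + 1 + 1) (j + 1 + 1)).comp (B.coface (n + 1) (i + 1)))
        ((B.coface (n + 1 + 1) (i + 1)).comp (B.coface (n + 1) (j + 1))) fun u w => ?_) x
      rw [LinearMap.comp_apply, LinearMap.comp_apply]
      rcases i with _ | i
      · rcases j with _ | j
        · rw [B.coface_one, ← B.consThree_ΔTens, B.coassoc, B.consThree_map_Δ]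
        · rw [B.coface_one, B.coface_succ_succ, B.coface_one, B.coface_consTwo]
      · obtain ⟨j, rfl⟩ : ∃ j', j = j' + 1 := ⟨j - 1, by omega⟩
        rw [B.coface_succ_succ, B.coface_succ_succ, B.coface_succ_succ, B.coface_succ_succ,
          ih (i + 1) (j + 1) (by omega) (by omega) w]

lemma act_one (M : LeftMod k A) (m : M) : M.act 1 m = m := by rw [map_one]; rfl

lemma codeg_zero_consTwo (n : ℕ) (w : B.cochain n) (z : B.Tens B.self) :
    B.codeg (n + 1) 0 (B.consTwo n w z) = B.cons n ((B.εTens B.self).lin z) w :=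
  LinearMap.congr_fun (B.tensor_ext (M := B.self)
    (f := (B.codeg (n + 1) 0).comp (B.consTwo n w))
    (g := ((B.cons n).flip w).comp (B.εTens B.self).lin) fun p (q : U) => by
      rw [LinearMap.comp_apply, LinearMap.comp_apply, B.consTwo_tmul, B.codeg_zero, B.εTens_tmul,
        B.act_cons]
      rfl) z

lemma codeg_one_consTwo (n : ℕ) (w : B.cochain n) (z : B.Tens B.self) :
    B.codeg (n + 1) 1 (B.consTwo n w z) = B.cons n (B.tensε z) w :=
  LinearMap.congr_fun (B.tensor_ext (M := B.self)
    (f := (B.codeg (n + 1) 1).comp (B.consTwo n w))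
    (g := ((B.cons n).flip w).comp B.tensε) fun p (q : U) => by
      rw [LinearMap.comp_apply, LinearMap.comp_apply, B.consTwo_tmul, B.codeg_succ n 0, B.tensε_tmul,
        B.codeg_zero, LinearMap.flip_apply, B.cons_act]) z

lemma codeg_coface_self : ∀ n j, j ≤ n → ∀ x : B.cochain n, B.codeg n j (B.coface n j x) = x := by
  intro n
  induction n with
  | zero =>
    intro j hj x
    obtain rfl : j = 0 := by omega
    rw [B.coface_zero, B.codeg_zero, B.ε_one, act_one]
  | succ n ih =>
    intro j hj x
    rcases j with _ | j
    · rw [B.coface_zero, B.codeg_zero, B.ε_one, act_one]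
    · refine LinearMap.congr_fun (B.cochain_ext
        ((B.codeg (n + 1) (j + 1)).comp (B.coface (n + 1) (j + 1)))
        LinearMap.id fun u w => ?_) x
      rw [LinearMap.comp_apply, LinearMap.id_apply]
      rcases j with _ | j
      · rw [B.coface_one, B.codeg_one_consTwo, B.counit_right]
      · rw [B.coface_succ_succ, B.codeg_succ, ih (j + 1) (by omega) w]

lemma codeg_coface_succ : ∀ n j, j ≤ n → ∀ x : B.cochain n,
    B.codeg n j (B.coface n (j + 1) x) = x := by
  intro n
  induction n with
  | zero =>
    intro j hj x
    obtain rfl : j = 0 := by omega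
    obtain ⟨a, ha⟩ := B.exists_base x
    rw [ha, B.coface_base, B.codeg_zero, ← mul_one (B.s _), B.ε_left, B.ε_one, B.act_base, mul_one,
      mul_one]
  | succ n ih =>
    intro j hj x
    refine LinearMap.congr_fun (B.cochain_ext
        ((B.codeg (n + 1) j).comp (B.coface (n + 1) (j + 1)))
        LinearMap.id fun u w => ?_) x
    rw [LinearMap.comp_apply, LinearMap.id_apply]
    rcases j with _ | j
    · rw [B.coface_one, B.codeg_zero_consTwo, B.counit_left]
    · rw [B.coface_succ_succ, B.codeg_succ, ih j (by omega) w]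

lemma codeg_coface_of_le : ∀ n i j, i ≤ j → j ≤ n → ∀ x : B.cochain (n + 1),
    B.codeg (n + 1) (j + 1) (B.coface (n + 1) i x) = B.coface n i (B.codeg n j x) := by
  intro n
  induction n with
  | zero =>
    intro i j hij hj x
    obtain rfl : j = 0 := by omega
    obtain rfl : i = 0 := by omega
    rw [B.coface_zero, B.codeg_succ, B.coface_zero]
  | succ n ih =>
    intro i j hij hj x
    rcases i with _ | i
    · rw [B.coface_zero, B.codeg_succ, B.coface_zero]
    · obtain ⟨j, rfl⟩ : ∃ j', j = j' + 1 := ⟨j - 1, by omega⟩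
      refine LinearMap.congr_fun (B.cochain_ext
        ((B.codeg (n + 1 + 1) (j + 1 + 1)).comp (B.coface (n + 1 + 1) (i + 1)))
        ((B.coface (n + 1) (i + 1)).comp (B.codeg (n + 1) (j + 1))) fun u w => ?_) x
      rw [LinearMap.comp_apply, LinearMap.comp_apply]
      rcases i with _ | i
      · rw [B.coface_one, B.codeg_succ, B.coface_one, B.codeg_consTwo]
      · rw [B.coface_succ_succ, B.codeg_succ, B.codeg_succ, B.coface_succ_succ,
          ih (i + 1) j (by omega) (by omega) w]

lemma codeg_coface_of_lt : ∀ n i j, j < i → i ≤ n + 1 → ∀ x : B.cochain (n + 1),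
    B.codeg (n + 1) j (B.coface (n + 1) (i + 1) x) = B.coface n i (B.codeg n j x) := by
  intro n i j hij hi x
  obtain ⟨i, rfl⟩ : ∃ i', i = i' + 1 := ⟨i - 1, by omega⟩
  induction n generalizing i j with
  | zero =>
    obtain rfl : i = 0 := by omega
    obtain rfl : j = 0 := by omega
    refine LinearMap.congr_fun (B.cochain_ext
        ((B.codeg (0 + 1) 0).comp (B.coface (0 + 1) (0 + 1 + 1)))
        ((B.coface 0 (0 + 1)).comp (B.codeg 0 0)) fun u w => ?_) x
    rw [LinearMap.comp_apply, LinearMap.comp_apply, B.coface_succ_succ, B.codeg_zero, B.codeg_zero,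
      B.coface_act]
  | succ n ih =>
    refine LinearMap.congr_fun (B.cochain_ext
        ((B.codeg (n + 1 + 1) j).comp (B.coface (n + 1 + 1) (i + 1 + 1)))
        ((B.coface (n + 1) (i + 1)).comp (B.codeg (n + 1) j)) fun u w => ?_) x
    rw [LinearMap.comp_apply, LinearMap.comp_apply]
    rcases j with _ | j
    · rw [B.coface_succ_succ, B.codeg_zero, B.codeg_zero, B.coface_act]
    · obtain ⟨i, rfl⟩ : ∃ i', i = i' + 1 := ⟨i - 1, by omega⟩
      rw [B.coface_succ_succ, B.codeg_succ, B.codeg_succ, B.coface_succ_succ,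
        ih j w i (by omega) (by omega)]

lemma codeg_codeg : ∀ n i j, i ≤ j → j ≤ n → ∀ x : B.cochain (n + 1 + 1),
    B.codeg n j (B.codeg (n + 1) i x) = B.codeg n i (B.codeg (n + 1) (j + 1) x) := by
  intro n i j hij hj x
  induction n generalizing i j with
  | zero =>
    obtain rfl : j = 0 := by omega
    obtain rfl : i = 0 := by omega
    refine LinearMap.congr_fun (B.cochain_ext
        ((B.codeg 0 0).comp (B.codeg (0 + 1) 0))
        ((B.codeg 0 0).comp (B.codeg (0 + 1) (0 + 1))) fun u w => ?_) x
    rw [LinearMap.comp_apply, LinearMap.comp_apply, B.codeg_succ, B.codeg_zero, B.codeg_zero,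
      B.codeg_act]
  | succ n ih =>
    refine LinearMap.congr_fun (B.cochain_ext
        ((B.codeg (n + 1) j).comp (B.codeg (n + 1 + 1) i))
        ((B.codeg (n + 1) i).comp (B.codeg (n + 1 + 1) (j + 1))) fun u w => ?_) x
    rw [LinearMap.comp_apply, LinearMap.comp_apply]
    rcases i with _ | i
    · rw [B.codeg_succ, B.codeg_zero, B.codeg_zero, B.codeg_act]
    · obtain ⟨j, rfl⟩ : ∃ j', j = j' + 1 := ⟨j - 1, by omega⟩
      rw [B.codeg_succ, B.codeg_succ, B.codeg_succ, B.codeg_succ, ih i j (by omega) (by omega) w]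

end LeftBialgebroid

namespace LeftBialgebroid

universe u v
variable {k : Type v} {A U : Type u} [Field k] [Ring A] [Algebra k A] [Ring U] [Algebra k U]
variable (B : LeftBialgebroid k A U)

lemma mulC_act (n : ℕ) (a : A) (z : B.Tens B.self) (u : U) (w : B.cochain n) :
    B.mulC n (B.tensActHom B.self a z) u w = (B.cochain (n + 1)).act a (B.mulC n z u w) :=
  LinearMap.congr_fun (B.tensor_ext (M := B.self)
    (f := (((B.mulC n).flip u).flip w).comp (B.tensActHom B.self a))
    (g := ((B.cochain (n + 1)).act a).comp (((B.mulC n).flip u).flip w)) fun p (q : U) => by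
      simp only [LinearMap.comp_apply, LinearMap.flip_apply]
      rw [B.tensActHom_tmul, B.mulC_tmul, B.mulC_tmul, B.act_cons, mul_assoc]) z

/-- `x ⊗ (y ⊗ z) ↦ x p ⊗ y q ⊗ z w`. -/
def tripleMul (n : ℕ) (p q : U) (w : B.cochain n) :
    B.Tens (B.tens B.self) →ₗ[k] B.cochain (n + 1 + 1) :=
  B.lift (M := B.tens B.self)
    ((B.cons (n + 1)).compl₁₂ (LinearMap.mulRight k p) (((B.mulC n).flip q).flip w)) (by
      intro a x z
      change B.cons (n + 1) (B.t (op a) * x * p) (B.mulC n z q w) =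
        B.cons (n + 1) (x * p) (B.mulC n (B.tensActHom B.self a z) q w)
      rw [B.mulC_act, mul_assoc, B.cons_act])

lemma tripleMul_tmul (n : ℕ) (p q : U) (w : B.cochain n) (x : U) (z : B.Tens B.self) :
    B.tripleMul n p q w (B.tmul (B.tens B.self) x z) = B.cons (n + 1) (x * p) (B.mulC n z q w) := by
  unfold tripleMul
  exact B.lift_tmul (M := B.tens B.self) _ _ x z

lemma exists_tripleMul (n : ℕ) (w : B.cochain n) (r : U ⊗[k] U) :
    ∃ T : B.Tens (B.tens B.self) →ₗ[k] B.cochain (n + 1 + 1),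
      (∀ x y, B.consTwo n ((B.cochainAct n).ρ y w) (B.rmul r (B.Δ x)) =
        T ((B.ΔTens B.self).lin (B.tmul B.self x y))) ∧
      (∀ h, (B.cochainAct (n + 1 + 1)).ρ h (B.consTwo n w (B.proj B.self r)) =
        T ((B.map B.ΔHom).lin (B.Δ h))) := by
  induction r using TensorProduct.induction_on with
  | zero => exact ⟨0, by simp, by simp⟩
  | tmul p q =>
    refine ⟨B.tripleMul n p q w, fun x y => ?_, fun h => ?_⟩
    · rw [B.ΔTens_tmul]
      exact LinearMap.congr_fun (B.tensor_ext (M := B.self)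
        (f := (B.consTwo n ((B.cochainAct n).ρ y w)).comp (B.rmul (p ⊗ₜ q)))
        (g := (B.tripleMul n p q w).comp (B.map (B.tmulHom B.self y)).lin) fun x' (y' : U) => by
          rw [LinearMap.comp_apply, LinearMap.comp_apply, B.rmul_tmul, B.consTwo_tmul, B.map_tmul,
            B.tripleMul_tmul]
          exact congrArg _ (B.mulC_tmul n y' y q w).symm) (B.Δ x)
    · have e : B.proj B.self (p ⊗ₜ[k] q) = B.tmul B.self p q := rfl
      rw [e, B.consTwo_tmul, B.act_cons']
      exact LinearMap.congr_fun (B.tensor_ext (M := B.self)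
        (f := ((B.mulC (n + 1)).flip p).flip (B.cons n q w))
        (g := (B.tripleMul n p q w).comp (B.map B.ΔHom).lin) fun x' (y' : U) => by
          rw [LinearMap.comp_apply, LinearMap.flip_apply, LinearMap.flip_apply, B.mulC_tmul,
            B.map_tmul, B.tripleMul_tmul, B.act_cons']
          rfl) (B.Δ h)
  | add r r' h h' =>
    obtain ⟨T, h1, h2⟩ := h
    obtain ⟨T', h1', h2'⟩ := h'
    refine ⟨T + T', fun x y => ?_, fun h => ?_⟩
    · rw [map_add, LinearMap.add_apply, map_add, h1, h1', LinearMap.add_apply]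
    · rw [map_add, map_add, map_add, h2, h2', LinearMap.add_apply]

/-- The inner cofaces commute with the diagonal action. -/
lemma coface_ρ : ∀ n i, i < n → ∀ (h : U) (x : B.cochain n),
    B.coface n (i + 1) ((B.cochainAct n).ρ h x) =
      (B.cochainAct (n + 1)).ρ h (B.coface n (i + 1) x) := by
  intro n
  induction n with
  | zero => intro i hi; omega
  | succ n ih =>
    intro i hi h x
    refine LinearMap.congr_fun (B.cochain_ext
      ((B.coface (n + 1) (i + 1)).comp ((B.cochainAct (n + 1)).ρ h))
      (((B.cochainAct (n + 1 + 1)).ρ h).comp (B.coface (n + 1) (i + 1))) fun u w => ?_) x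
    rw [LinearMap.comp_apply, LinearMap.comp_apply, B.act_cons']
    rcases i with _ | i
    · obtain ⟨r, hr⟩ := B.proj_surjective B.self (B.Δ u)
      obtain ⟨T, h1, h2⟩ := B.exists_tripleMul n w r
      rw [B.coface_one, ← hr, h2, ← B.coassoc]
      exact LinearMap.congr_fun (B.tensor_ext (M := B.self)
        (f := (B.coface (n + 1) 1).comp (((B.mulC n).flip u).flip w))
        (g := T.comp (B.ΔTens B.self).lin) fun x' (y' : U) => by
          rw [LinearMap.comp_apply, LinearMap.comp_apply, LinearMap.flip_apply,
            LinearMap.flip_apply, B.mulC_tmul, B.coface_one, B.Δ_mul x' u r hr, h1]) (B.Δ h)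
    · rw [B.coface_succ_succ, B.act_cons']
      exact LinearMap.congr_fun (B.tensor_ext (M := B.self)
        (f := (B.coface (n + 1) (i + 1 + 1)).comp (((B.mulC n).flip u).flip w))
        (g := ((B.mulC (n + 1)).flip u).flip (B.coface n (i + 1) w)) fun x' (y' : U) => by
          rw [LinearMap.comp_apply, LinearMap.flip_apply, LinearMap.flip_apply,
            LinearMap.flip_apply, LinearMap.flip_apply, B.mulC_tmul, B.coface_succ_succ,
            B.mulC_tmul, ih i (by omega)]) (B.Δ h)

lemma ρ_mul (n : ℕ) (g h : U) (x : B.cochain n) :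
    (B.cochainAct n).ρ (g * h) x = (B.cochainAct n).ρ g ((B.cochainAct n).ρ h x) := by
  rw [map_mul]; rfl

lemma ρ_one (n : ℕ) (x : B.cochain n) : (B.cochainAct n).ρ 1 x = x := by
  rw [map_one]; rfl

lemma codeg_zero_mulC (n : ℕ) (u : U) (w : B.cochain n) (z : B.Tens B.self) :
    B.codeg n 0 (B.mulC n z u w) =
      (B.cochainAct n).ρ ((B.εTens B.self).lin (B.rmul (B.s (B.ε u) ⊗ₜ 1) z)) w :=
  LinearMap.congr_fun (B.tensor_ext (M := B.self)
    (f := (B.codeg n 0).comp (((B.mulC n).flip u).flip w))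
    (g := (((B.cochainAct n).ρ.toLinearMap.flip w).comp (B.εTens B.self).lin).comp
      (B.rmul (B.s (B.ε u) ⊗ₜ 1))) fun x' (y' : U) => by
      rw [LinearMap.comp_apply, LinearMap.comp_apply, LinearMap.comp_apply, LinearMap.flip_apply,
        LinearMap.flip_apply, B.mulC_tmul, B.rmul_tmul, B.codeg_zero, B.εTens_tmul, mul_one,
        B.ε_mul_s, ← (B.cochainAct n).ρ_s]
      exact (B.ρ_mul n _ y' w).symm) z

/-- The codegeneracies commute with the diagonal action. -/
lemma codeg_ρ : ∀ n i, i ≤ n → ∀ (h : U) (x : B.cochain (n + 1)),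
    B.codeg n i ((B.cochainAct (n + 1)).ρ h x) = (B.cochainAct n).ρ h (B.codeg n i x) := by
  intro n
  have h0 : ∀ (n : ℕ) (h : U) (x : B.cochain (n + 1)),
    B.codeg n 0 ((B.cochainAct (n + 1)).ρ h x) = (B.cochainAct n).ρ h (B.codeg n 0 x) := by
    intro n h x
    refine LinearMap.congr_fun (B.cochain_ext
      ((B.codeg n 0).comp ((B.cochainAct (n + 1)).ρ h))
      (((B.cochainAct n).ρ h).comp (B.codeg n 0)) fun u w => ?_) x
    rw [LinearMap.comp_apply, LinearMap.comp_apply, B.act_cons', B.codeg_zero_mulC, ← B.Δ_mul_s,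
      B.counit_left, B.codeg_zero, B.ρ_mul, (B.cochainAct n).ρ_s]
  induction n with
  | zero =>
    intro i hi h x
    obtain rfl : i = 0 := by omega
    exact h0 0 h x
  | succ n ih =>
    intro i hi h x
    rcases i with _ | i
    · exact h0 (n + 1) h x
    · refine LinearMap.congr_fun (B.cochain_ext
        ((B.codeg (n + 1) (i + 1)).comp ((B.cochainAct (n + 1 + 1)).ρ h))
        (((B.cochainAct (n + 1)).ρ h).comp (B.codeg (n + 1) (i + 1))) fun u w => ?_) x
      rw [LinearMap.comp_apply, LinearMap.comp_apply, B.act_cons', B.codeg_succ, B.act_cons']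
      exact LinearMap.congr_fun (B.tensor_ext (M := B.self)
        (f := (B.codeg (n + 1) (i + 1)).comp (((B.mulC (n + 1)).flip u).flip w))
        (g := ((B.mulC n).flip u).flip (B.codeg n i w)) fun x' (y' : U) => by
          rw [LinearMap.comp_apply, LinearMap.flip_apply, LinearMap.flip_apply,
            LinearMap.flip_apply, LinearMap.flip_apply, B.mulC_tmul, B.codeg_succ,
            B.mulC_tmul, ih i (by omega)]) (B.Δ h)

lemma codeg_last_snoc (u : U) : ∀ n (x : B.cochain n),
    B.codeg n n ((B.snoc u n).lin x) = (B.cochainAct n).ρ (B.t (op (B.ε u))) x := by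
  intro n
  induction n with
  | zero =>
    intro x
    obtain ⟨a, ha⟩ := B.exists_base x
    rw [ha, B.snoc_base, B.codeg_zero, B.act_base, B.act_base', B.ε_left, B.ε_right,
      ← mul_one (B.s a), B.ε_left, B.ε_one, mul_one, mul_one]
  | succ n ih =>
    intro x
    refine LinearMap.congr_fun (B.cochain_ext
      ((B.codeg (n + 1) (n + 1)).comp (B.snoc u (n + 1)).lin)
      ((B.cochainAct (n + 1)).ρ (B.t (op (B.ε u)))) fun v w => ?_) x
    rw [LinearMap.comp_apply, B.snoc_cons, B.codeg_succ, ih, B.act_cons', B.Δ_t, B.mulC_tmul,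
      one_mul]

lemma mulC_zero_base (z : B.Tens B.self) (u : U) :
    B.mulC 0 z u (B.base 1) = B.cons 0 (B.tensε z * u) (B.base 1) :=
  LinearMap.congr_fun (B.tensor_ext (M := B.self)
    (f := ((B.mulC 0).flip u).flip (B.base 1))
    (g := ((B.cons 0).flip (B.base 1)).comp ((LinearMap.mulRight k u).comp B.tensε))
    fun x' (y' : U) => by
      rw [LinearMap.comp_apply, LinearMap.comp_apply, LinearMap.flip_apply, LinearMap.flip_apply,
        B.mulC_tmul, B.tensε_tmul, LinearMap.flip_apply, LinearMap.mulRight_apply, mul_assoc,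
        B.cons_act, B.act_base, B.act_base', map_one, mul_one, mul_one]) z

lemma ρ_one_base (g u : U) :
    (B.cochainAct 1).ρ g (B.cons 0 u (B.base 1)) = B.cons 0 (g * u) (B.base 1) := by
  rw [B.act_cons', B.mulC_zero_base, B.counit_right]

end LeftBialgebroid

namespace HopfAlgebroid

universe u v
variable {k : Type v} {A U : Type u} [Field k] [Ring A] [Algebra k A] [Ring U] [Algebra k U]
variable (H : HopfAlgebroid k A U)

lemma S_s (a : A) : H.S (H.s a) = H.t (op a) := by rw [← H.S_t, H.S_S]

/-- `x ⊗ y ↦ S(x) · (y v ⊗ w)`. -/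
def lam (n : ℕ) (v : U) (w : H.cochain n) : H.Tens H.self →ₗ[k] H.cochain (n + 1) :=
  H.lift (M := H.self) (((H.cochainAct (n + 1)).ρ.toLinearMap.comp H.S).compl₂
    (((H.cons n).flip w).comp (LinearMap.mulRight k v))) (by
    intro a x y
    change (H.cochainAct (n + 1)).ρ (H.S (H.t (op a) * x)) (H.cons n ((y : U) * v) w) =
      (H.cochainAct (n + 1)).ρ (H.S x) (H.cons n (H.s a * (y : U) * v) w)
    rw [H.S_t_mul, H.ρ_mul, (H.cochainAct (n + 1)).ρ_s, H.act_cons, mul_assoc])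

lemma lam_tmul (n : ℕ) (v : U) (w : H.cochain n) (x y : U) :
    H.lam n v w (H.tmul H.self x y) = (H.cochainAct (n + 1)).ρ (H.S x) (H.cons n (y * v) w) := by
  unfold lam
  exact H.lift_tmul (M := H.self) _ _ x y

lemma lam_Δ (n : ℕ) (v : U) (w : H.cochain n) (h : U) :
    H.lam n v w (H.Δ h) = H.cons n v ((H.cochainAct n).ρ (H.S h) w) := by
  obtain ⟨p, hp⟩ := H.proj_surjective H.self (H.Δ h)
  have e := H.antipode_left h p hp
  have key := H.mulC_tmul n 1 (H.S h) v w
  rw [← e, one_mul] at key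
  rw [← key, ← hp]
  clear key e hp
  induction p using TensorProduct.induction_on with
  | zero => simp
  | tmul x y =>
    have e : H.proj H.self (x ⊗ₜ[k] y) = H.tmul H.self x y := rfl
    rw [e, H.lam_tmul, H.act_cons', TensorProduct.lift.tmul, LinearMap.mk₂_apply, H.mulC_rmul,
      H.ρ_one]
  | add p q hp hq => rw [map_add, map_add, hp, hq, map_add, map_add]; rfl

/-- `x ⊗ y ↦ S(x) · ((y · w) ⊗ 1)`. -/
def twist (n : ℕ) (w : H.cochain n) : H.Tens H.self →ₗ[k] H.cochain (n + 1) :=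
  H.lift (M := H.self) (((H.cochainAct (n + 1)).ρ.toLinearMap.comp H.S).compl₂
    ((H.snoc 1 n).lin.comp ((H.cochainAct n).ρ.toLinearMap.flip w))) (by
    intro a x y
    change (H.cochainAct (n + 1)).ρ (H.S (H.t (op a) * x))
        ((H.snoc 1 n).lin ((H.cochainAct n).ρ (y : U) w)) =
      (H.cochainAct (n + 1)).ρ (H.S x) ((H.snoc 1 n).lin ((H.cochainAct n).ρ (H.s a * (y : U)) w))
    rw [H.S_t_mul, H.ρ_mul, (H.cochainAct (n + 1)).ρ_s, H.ρ_mul, (H.cochainAct n).ρ_s,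
      (H.snoc 1 n).map_act])

lemma twist_tmul (n : ℕ) (w : H.cochain n) (x y : U) :
    H.twist n w (H.tmul H.self x y) =
      (H.cochainAct (n + 1)).ρ (H.S x) ((H.snoc 1 n).lin ((H.cochainAct n).ρ y w)) := by
  unfold twist
  exact H.lift_tmul (M := H.self) _ _ x y

/-- `x ⊗ (y ⊗ z) ↦ S(x) · ((y u ⊗ z w) ⊗ 1)`. -/
def twistThree (n : ℕ) (u : U) (w : H.cochain n) :
    H.Tens (H.tens H.self) →ₗ[k] H.cochain (n + 1 + 1) :=
  H.lift (M := H.tens H.self) (((H.cochainAct (n + 1 + 1)).ρ.toLinearMap.comp H.S).compl₂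
    ((H.snoc 1 (n + 1)).lin.comp (((H.mulC n).flip u).flip w))) (by
    intro a x z
    change (H.cochainAct (n + 1 + 1)).ρ (H.S (H.t (op a) * x))
        ((H.snoc 1 (n + 1)).lin (H.mulC n z u w)) =
      (H.cochainAct (n + 1 + 1)).ρ (H.S x)
        ((H.snoc 1 (n + 1)).lin (H.mulC n (H.tensActHom H.self a z) u w))
    rw [H.S_t_mul, H.ρ_mul, (H.cochainAct (n + 1 + 1)).ρ_s, H.mulC_act,
      (H.snoc 1 (n + 1)).map_act])

lemma twistThree_tmul (n : ℕ) (u : U) (w : H.cochain n) (x : U) (z : H.Tens H.self) :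
    H.twistThree n u w (H.tmul (H.tens H.self) x z) =
      (H.cochainAct (n + 1 + 1)).ρ (H.S x) ((H.snoc 1 (n + 1)).lin (H.mulC n z u w)) := by
  unfold twistThree
  exact H.lift_tmul (M := H.tens H.self) _ _ x z

/-- `S(h₁) · ((h₂ · w) ⊗ 1) = w ⊗ S(h)`. -/
lemma twist_Δ : ∀ n (w : H.cochain n) (h : U),
    H.twist n w (H.Δ h) = (H.snoc (H.S h) n).lin w := by
  intro n
  induction n with
  | zero =>
    intro w h
    obtain ⟨a, ha⟩ := H.exists_base w
    have e : ∀ z, H.twist 0 (H.base a) z =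
        H.cons 0 (H.S (H.tensε (H.rmul (1 ⊗ₜ H.s a) z))) (H.base 1) :=
      LinearMap.congr_fun (H.tensor_ext (M := H.self) (f := H.twist 0 (H.base a))
        (g := ((H.cons 0).flip (H.base 1)).comp (H.S.comp (H.tensε.comp (H.rmul (1 ⊗ₜ H.s a)))))
        fun x (y : U) => by
          rw [H.twist_tmul, LinearMap.comp_apply, LinearMap.comp_apply, LinearMap.comp_apply,
            H.rmul_tmul, H.tensε_tmul, LinearMap.flip_apply, H.act_base', H.snoc_base,
            H.ρ_one_base, H.S_t_mul, mul_one, mul_one])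
    have e2 : ∀ z, H.tensε (H.rmul (H.t (op a) ⊗ₜ 1) z) = H.tensε z * H.t (op a) :=
      LinearMap.congr_fun (H.tensor_ext (M := H.self)
        (f := H.tensε.comp (H.rmul (H.t (op a) ⊗ₜ 1)))
        (g := (LinearMap.mulRight k (H.t (op a))).comp H.tensε) fun x (y : U) => by
          rw [LinearMap.comp_apply, LinearMap.comp_apply, H.rmul_tmul, H.tensε_tmul, H.tensε_tmul,
            LinearMap.mulRight_apply, mul_one, mul_assoc])
    rw [ha, e, ← H.takeuchi, e2, H.counit_right, H.snoc_base, H.S_mul, H.S_t]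
  | succ n ih =>
    intro x
    refine H.cochain_induction (P := fun x => ∀ h,
      H.twist (n + 1) x (H.Δ h) = (H.snoc (H.S h) (n + 1)).lin x) ?_ ?_ x
    · intro u w h
      have e1 : ∀ z, H.twist (n + 1) (H.cons n u w) z = H.twistThree n u w ((H.map H.ΔHom).lin z) :=
        LinearMap.congr_fun (H.tensor_ext (M := H.self) (f := H.twist (n + 1) (H.cons n u w))
          (g := (H.twistThree n u w).comp (H.map H.ΔHom).lin) fun x (y : U) => by
            rw [H.twist_tmul, LinearMap.comp_apply, H.map_tmul, H.twistThree_tmul, H.act_cons']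
            rfl)
      have e2 : ∀ z, H.twistThree n u w ((H.ΔTens H.self).lin z) =
          H.cons (n + 1) u (H.twist n w z) :=
        LinearMap.congr_fun (H.tensor_ext (M := H.self)
          (f := (H.twistThree n u w).comp (H.ΔTens H.self).lin)
          (g := (H.cons (n + 1) u).comp (H.twist n w)) fun x (y : U) => by
            rw [LinearMap.comp_apply, LinearMap.comp_apply, H.ΔTens_tmul, H.twist_tmul,
              ← H.lam_Δ]
            exact LinearMap.congr_fun (H.tensor_ext (M := H.self)
              (f := (H.twistThree n u w).comp (H.map (H.tmulHom H.self y)).lin)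
              (g := H.lam (n + 1) u ((H.snoc 1 n).lin ((H.cochainAct n).ρ y w)))
              fun x' (y' : U) => by
                rw [LinearMap.comp_apply, H.map_tmul, H.twistThree_tmul, H.lam_tmul]
                have e3 : H.mulC n ((H.tmulHom H.self y).lin y') u w =
                    H.cons n (y' * u) ((H.cochainAct n).ρ y w) := H.mulC_tmul n y' y u w
                rw [e3, H.snoc_cons]) (H.Δ x))
      rw [e1, ← H.coassoc, e2, ih, H.snoc_cons]
    · intro x y hx hy h
      have e : ∀ z, H.twist (n + 1) (x + y) z = H.twist (n + 1) x z + H.twist (n + 1) y z :=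
        LinearMap.congr_fun (H.tensor_ext (M := H.self) (f := H.twist (n + 1) (x + y))
          (g := H.twist (n + 1) x + H.twist (n + 1) y) fun p (q : U) => by
            rw [LinearMap.add_apply, H.twist_tmul, H.twist_tmul, H.twist_tmul, map_add, map_add,
              map_add])
      rw [e, hx, hy, map_add]

/-- `τ(S(v) · (u ⊗ w)) = S(u) · (w ⊗ v)`. -/
lemma cyc_step (n : ℕ) (v u : U) (w : H.cochain n) :
    H.cyc (n + 1) ((H.cochainAct (n + 1)).ρ (H.S v) (H.cons n u w)) =
      (H.cochainAct (n + 1)).ρ (H.S u) ((H.snoc v n).lin w) := by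
  have e : ∀ z, H.cyc (n + 1) (H.mulC n z u w) =
      (H.cochainAct (n + 1)).ρ (H.S u) (H.twist n w z) :=
    LinearMap.congr_fun (H.tensor_ext (M := H.self)
      (f := (H.cyc (n + 1)).comp (((H.mulC n).flip u).flip w))
      (g := ((H.cochainAct (n + 1)).ρ (H.S u)).comp (H.twist n w)) fun x (y : U) => by
        rw [LinearMap.comp_apply, LinearMap.comp_apply, LinearMap.flip_apply, LinearMap.flip_apply,
          H.mulC_tmul, H.cyc_cons, H.twist_tmul, H.S_mul, H.ρ_mul])
  rw [H.act_cons', e, H.twist_Δ, H.S_S]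

lemma cyc_coface_zero (n : ℕ) (x : H.cochain n) :
    H.cyc (n + 1) (H.coface n 0 x) = H.coface n (n + 1) x := by
  rw [H.coface_zero, H.cyc_cons, H.S_one, H.ρ_one, H.coface_last]

lemma cyc_coface_succ (n i : ℕ) (hi : i ≤ n) (x : H.cochain n) :
    H.cyc (n + 1) (H.coface n (i + 1) x) = H.coface n i (H.cyc n x) := by
  rcases n with _ | n
  · obtain rfl : i = 0 := by omega
    obtain ⟨a, ha⟩ := H.exists_base x
    have e : H.cyc 0 (H.base a) = H.base a := rfl
    rw [ha, e, H.coface_base, H.cyc_cons, H.snoc_base, H.ρ_one_base, H.S_s, H.coface_zero, map_one,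
      mul_one, H.cons_act, H.act_base, mul_one]
  · refine LinearMap.congr_fun (H.cochain_ext
      ((H.cyc (n + 1 + 1)).comp (H.coface (n + 1) (i + 1)))
      ((H.coface (n + 1) i).comp (H.cyc (n + 1))) fun u w => ?_) x
    rw [LinearMap.comp_apply, LinearMap.comp_apply]
    rcases i with _ | i
    · have e : ∀ z, H.cyc (n + 1 + 1) (H.consTwo n w z) = H.lam (n + 1) 1 ((H.snoc 1 n).lin w) z :=
        LinearMap.congr_fun (H.tensor_ext (M := H.self)
          (f := (H.cyc (n + 1 + 1)).comp (H.consTwo n w))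
          (g := H.lam (n + 1) 1 ((H.snoc 1 n).lin w)) fun x (y : U) => by
            rw [LinearMap.comp_apply, H.consTwo_tmul, H.cyc_cons, H.snoc_cons, H.lam_tmul, mul_one])
      rw [H.coface_one, e, H.lam_Δ, H.cyc_cons, H.coface_zero]
    · rw [H.coface_succ_succ, H.cyc_cons, H.cyc_cons, ← H.coface_last,
        H.coface_coface n (i + 1) (n + 1) (by omega) le_rfl, H.coface_last,
        H.coface_ρ (n + 1) i (by omega)]

lemma cyc_codeg_succ (n i : ℕ) (hi : i + 1 ≤ n) (x : H.cochain (n + 1)) :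
    H.cyc n (H.codeg n (i + 1) x) = H.codeg n i (H.cyc (n + 1) x) := by
  obtain ⟨n, rfl⟩ : ∃ n', n = n' + 1 := ⟨n - 1, by omega⟩
  refine LinearMap.congr_fun (H.cochain_ext
      ((H.cyc (n + 1)).comp (H.codeg (n + 1) (i + 1)))
      ((H.codeg (n + 1) i).comp (H.cyc (n + 1 + 1))) fun u w => ?_) x
  rw [LinearMap.comp_apply, LinearMap.comp_apply, H.codeg_succ, H.cyc_cons, H.cyc_cons,
    H.codeg_ρ (n + 1) i (by omega), ← H.coface_last, ← H.coface_last,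
    H.codeg_coface_of_lt n (n + 1) i (by omega) le_rfl]

lemma pure_congr {F G : ℕ → U} : ∀ n, (∀ i < n, F i = G i) → H.pure n F = H.pure n G := by
  intro n
  induction n generalizing F G with
  | zero => intro; rfl
  | succ n ih =>
    intro h
    have e := ih (F := fun i => F (i + 1)) (G := fun i => G (i + 1)) fun i hi => h (i + 1) (by omega)
    change H.cons n (F 0) (H.pure n fun i => F (i + 1)) = H.cons n (G 0) (H.pure n fun i => G (i + 1))
    rw [e, h 0 (by omega)]

lemma pure_succ (n : ℕ) (F : ℕ → U) :
    H.pure (n + 1) F = H.cons n (F 0) (H.pure n fun i => F (i + 1)) := rfl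

lemma snoc_pure (n : ℕ) (F : ℕ → U) : (H.snoc (F n) n).lin (H.pure n F) = H.pure (n + 1) F := by
  induction n generalizing F with
  | zero =>
    change (H.snoc (F 0) 0).lin (H.base 1) = H.cons 0 (F 0) (H.base 1)
    rw [H.snoc_base, map_one, one_mul]
  | succ n ih =>
    rw [H.pure_succ n, H.snoc_cons, ih (fun i => F (i + 1)), H.pure_succ (n + 1)]

lemma pure_ext (n : ℕ) {N : Type*} [AddCommGroup N] [Module k N] (f g : H.cochain (n + 1) →ₗ[k] N)
    (h : ∀ F, f (H.pure (n + 1) F) = g (H.pure (n + 1) F)) : f = g := by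
  induction n generalizing N with
  | zero =>
    refine H.cochain_ext f g fun u w => ?_
    obtain ⟨a, ha⟩ := H.exists_base w
    have e := h fun _ => H.t (op a) * u
    rw [H.pure_succ] at e
    have e0 : H.pure 0 (fun _ => H.t (op a) * u) = H.base 1 := rfl
    rw [e0, H.cons_act, H.act_base, mul_one] at e
    rw [ha, e]
  | succ n ih =>
    refine H.cochain_ext f g fun u w => ?_
    refine LinearMap.congr_fun (ih (f.comp (H.cons (n + 1) u)) (g.comp (H.cons (n + 1) u))
      fun F => ?_) w
    exact h fun i => Nat.casesOn i u F

lemma cyc_pow_pure (n : ℕ) (F : ℕ → U) (h1 : F (n + 1) = 1) (hF : ∀ i, F (i + (n + 2)) = F i)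
    (j : ℕ) : (H.cyc (n + 1) ^ (j + 1)) (H.pure (n + 1) F) =
      (H.cochainAct (n + 1)).ρ (H.S (F j)) (H.pure (n + 1) fun i => F (i + (j + 1))) := by
  induction j with
  | zero =>
    have e := H.snoc_pure n fun i => F (i + 1)
    rw [h1] at e
    rw [zero_add, pow_one, H.pure_succ, H.cyc_cons, e]
  | succ j ih =>
    have e := H.snoc_pure n fun i => F (i + 1 + (j + 1))
    have e' : F (n + 1 + (j + 1)) = F j := by rw [← hF j]; congr 1; omega
    rw [e'] at e
    rw [pow_succ', Module.End.mul_apply, ih, H.pure_succ n, H.cyc_step, e, zero_add]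
    congr 1
    exact H.pure_congr _ fun i _ => by congr 1; omega

lemma cyc_pow (n : ℕ) : H.cyc n ^ (n + 1) = 1 := by
  rcases n with _ | n
  · rfl
  · refine H.pure_ext n _ _ fun G => ?_
    let F : ℕ → U := fun i => if i % (n + 2) = n + 1 then 1 else G (i % (n + 2))
    have h1 : F (n + 1) = 1 := by
      have : (n + 1) % (n + 2) = n + 1 := Nat.mod_eq_of_lt (by omega)
      simp only [F, this, if_true]
    have hF : ∀ i, F (i + (n + 2)) = F i := fun i => by simp only [F, Nat.add_mod_right]
    have hG : H.pure (n + 1) G = H.pure (n + 1) F := H.pure_congr _ fun i hi => by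
      have : i % (n + 2) = i := Nat.mod_eq_of_lt (by omega)
      simp only [F, this, if_neg (by omega : ¬ i = n + 1)]
    rw [hG, H.cyc_pow_pure n F h1 hF, h1, H.S_one, H.ρ_one]
    exact H.pure_congr _ fun i _ => hF i

lemma cyc_codeg_zero (n : ℕ) (x : H.cochain (n + 1)) :
    H.cyc n (H.codeg n 0 x) = H.codeg n n (H.cyc (n + 1) (H.cyc (n + 1) x)) := by
  rcases n with _ | n
  · have e := LinearMap.congr_fun (H.cyc_pow 1) x
    rw [pow_two] at e
    exact congrArg (H.codeg 0 0) e.symm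
  · refine LinearMap.congr_fun (H.cochain_ext
      ((H.cyc (n + 1)).comp (H.codeg (n + 1) 0))
      (((H.codeg (n + 1) (n + 1)).comp (H.cyc (n + 1 + 1))).comp (H.cyc (n + 1 + 1)))
      fun u w => ?_) x
    refine LinearMap.congr_fun (H.cochain_ext
      (((H.cyc (n + 1)).comp (H.codeg (n + 1) 0)).comp (H.cons (n + 1) u))
      ((((H.codeg (n + 1) (n + 1)).comp (H.cyc (n + 1 + 1))).comp (H.cyc (n + 1 + 1))).comp
        (H.cons (n + 1) u)) fun v w => ?_) w
    simp only [LinearMap.comp_apply]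
    rw [H.codeg_zero, H.act_cons, H.cyc_cons, H.cyc_cons, H.snoc_cons, H.cyc_step,
      H.codeg_ρ _ _ le_rfl, H.codeg_last_snoc, H.S_mul, H.S_s, H.ρ_mul]

/-- The cocyclic module `C^•(U)` of a Hopf algebroid with involutive antipode. -/
def cocyclic : CocyclicModule k where
  X n := H.cochain n
  δ := H.coface
  σ := H.codeg
  τ := H.cyc
  δ_δ := H.coface_coface
  σ_σ := H.codeg_codeg
  σ_δ_of_le := H.codeg_coface_of_le
  σ_δ_self := H.codeg_coface_self
  σ_δ_succ := H.codeg_coface_succ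
  σ_δ_of_lt := H.codeg_coface_of_lt
  τ_δ_zero := H.cyc_coface_zero
  τ_δ_succ := H.cyc_coface_succ
  τ_σ_zero := H.cyc_codeg_zero
  τ_σ_succ := H.cyc_codeg_succ
  τ_pow := H.cyc_pow

end HopfAlgebroid

/-! ### Hochschild and cyclic cohomology of a cocyclic module -/

namespace CocyclicModule

universe u u' v
variable {k : Type v} [Field k]

instance (X : CocyclicModule.{u} k) (n : ℕ) : AddCommGroup (X.X n) := X.grp n
instance (X : CocyclicModule.{u} k) (n : ℕ) : Module k (X.X n) := X.mod n

/-- Morphisms of cocyclic modules. -/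
structure Hom (X : CocyclicModule.{u} k) (Y : CocyclicModule.{u'} k) where
  /-- the components -/
  app : ∀ n, X.X n →ₗ[k] Y.X n
  app_δ : ∀ n i, i ≤ n + 1 → ∀ x, app (n + 1) (X.δ n i x) = Y.δ n i (app n x)
  app_σ : ∀ n i, i ≤ n → ∀ x, app n (X.σ n i x) = Y.σ n i (app (n + 1) x)
  app_τ : ∀ n x, app n (X.τ n x) = Y.τ n (app n x)

variable (X : CocyclicModule.{u} k)

/-- The Hochschild differential `b = ∑_{i=0}^{n+1} (-1)^i δ_i` on `Xⁿ`. -/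
def b (n : ℕ) : X.X n →ₗ[k] X.X (n + 1) := ∑ i ∈ Finset.range (n + 2), (-1 : k) ^ i • X.δ n i

/-- `b' = ∑_{i=0}^{n} (-1)^i δ_i` on `Xⁿ`. -/
def b' (n : ℕ) : X.X n →ₗ[k] X.X (n + 1) := ∑ i ∈ Finset.range (n + 1), (-1 : k) ^ i • X.δ n i

/-- The signed cyclic operator `λ = (-1)ⁿ τₙ` on `Xⁿ`. -/
def lam (n : ℕ) : X.X n →ₗ[k] X.X n := (-1 : k) ^ n • X.τ n

/-- The norm operator `N = ∑_{i=0}^{n} λ^i` on `Xⁿ`. -/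
def norm (n : ℕ) : X.X n →ₗ[k] X.X n := ∑ i ∈ Finset.range (n + 1), X.lam n ^ i

/-- The vertical differential `X^q → X^{q+1}` in the column `p` of the cyclic bicomplex: `b` if `p` is
even, `-b'` if `p` is odd. -/
def vert (p q : ℕ) : X.X q →ₗ[k] X.X (q + 1) := if Even p then X.b q else -X.b' q

/-- The horizontal differential from the column `p` to the column `p + 1` in the row `q` of the cyclic
bicomplex: `1 - λ` if `p` is even, `N` if `p` is odd. -/
def horiz (p q : ℕ) : X.X q →ₗ[k] X.X q := if Even p then 1 - X.lam q else X.norm q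

/-- Degree `n` of the total complex of the cyclic bicomplex: the entry in the row `q` lies in the column
`n - q`. -/
abbrev Tot (n : ℕ) : Type u := (q : Fin (n + 1)) → X.X q

/-- The part of the differential of the total complex that lands in the row `q`. -/
def totDEntry (n : ℕ) (q : Fin (n + 2)) : X.Tot n →ₗ[k] X.X q :=
  (if h : (q : ℕ) < n + 1 then X.horiz (n - q) q ∘ₗ LinearMap.proj (⟨q, h⟩ : Fin (n + 1)) else 0) +
    Fin.cases (motive := fun q : Fin (n + 2) => X.Tot n →ₗ[k] X.X q) 0
      (fun q' : Fin (n + 1) => X.vert (n - q') q' ∘ₗ LinearMap.proj q') q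

/-- The differential of the total complex of the cyclic bicomplex. -/
def totD (n : ℕ) : X.Tot n →ₗ[k] X.Tot (n + 1) := LinearMap.pi (X.totDEntry n)

/-- The map of total complexes that applies a morphism of cocyclic modules to every entry. -/
def Hom.tot {X : CocyclicModule.{u} k} {Y : CocyclicModule.{u'} k} (F : X.Hom Y) (n : ℕ) :
    X.Tot n →ₗ[k] Y.Tot n :=
  LinearMap.pi fun q => F.app q ∘ₗ LinearMap.proj q

end CocyclicModule

section Cohomology

universe u v
variable {k : Type v} [Field k] {Y : ℕ → Type u} [∀ n, AddCommGroup (Y n)] [∀ n, Module k (Y n)]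

/-- The coboundaries in degree `n`. -/
def coboundaries (d : ∀ n, Y n →ₗ[k] Y (n + 1)) : (n : ℕ) → Submodule k (Y n)
  | 0 => ⊥
  | n + 1 => LinearMap.range (d n)

/-- The `n`-th cohomology of a cochain complex `Y⁰ → Y¹ → ⋯`. -/
abbrev Cohomology (d : ∀ n, Y n →ₗ[k] Y (n + 1)) (n : ℕ) : Type u :=
  LinearMap.ker (d n) ⧸ (coboundaries d n).submoduleOf (LinearMap.ker (d n))

/-- The class of a cocycle. -/
def Cohomology.mk (d : ∀ n, Y n →ₗ[k] Y (n + 1)) (n : ℕ) (z : Y n) (hz : d n z = 0) :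
    Cohomology d n :=
  ((coboundaries d n).submoduleOf (LinearMap.ker (d n))).mkQ ⟨z, hz⟩

end Cohomology

namespace CocyclicModule

universe u v
variable {k : Type v} [Field k] (X : CocyclicModule.{u} k)

/-- Hochschild cohomology: the cohomology of `(X^•, b)`. -/
abbrev HH (n : ℕ) : Type u := Cohomology X.b n

/-- Cyclic cohomology: the cohomology of the total complex of the cyclic bicomplex. -/
abbrev HC (n : ℕ) : Type u := Cohomology X.totD n

end CocyclicModule

/-! ### Measurings -/

section Measuring

universe v w
variable {k : Type v} [Field k] {C : Type w} [AddCommGroup C] [Module k C]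
variable {V V' W W' N : Type*} [AddCommGroup V] [Module k V] [AddCommGroup V'] [Module k V']
  [AddCommGroup W] [Module k W] [AddCommGroup W'] [Module k W'] [AddCommGroup N] [Module k N]

/-- `c ⊗ d ↦ ((p, q) ↦ β (f c p) (g d q))`. -/
def sweedlerAux (β : V' →ₗ[k] W' →ₗ[k] N) (f : C →ₗ[k] V →ₗ[k] V') (g : C →ₗ[k] W →ₗ[k] W') :
    C ⊗[k] C →ₗ[k] V →ₗ[k] W →ₗ[k] N :=
  TensorProduct.lift (LinearMap.mk₂ k (fun c d => β.compl₁₂ (f c) (g d))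
    (fun c c' d => by ext; simp) (fun r c d => by ext; simp)
    (fun c d d' => by ext; simp) (fun r c d => by ext; simp))

@[simp] lemma sweedlerAux_tmul (β : V' →ₗ[k] W' →ₗ[k] N) (f : C →ₗ[k] V →ₗ[k] V')
    (g : C →ₗ[k] W →ₗ[k] W') (c d : C) (p : V) (q : W) :
    sweedlerAux β f g (c ⊗ₜ d) p q = β (f c p) (g d q) := by
  simp [sweedlerAux]

variable [Coalgebra k C]

/-- `(x, p, q) ↦ β (f x₁ p) (g x₂ q)`, where `x₁ ⊗ x₂` is the comultiplication of `x`. -/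
def sweedler (β : V' →ₗ[k] W' →ₗ[k] N) (f : C →ₗ[k] V →ₗ[k] V') (g : C →ₗ[k] W →ₗ[k] W') :
    C →ₗ[k] V →ₗ[k] W →ₗ[k] N :=
  (sweedlerAux β f g).comp Coalgebra.comul

/-- A measuring of algebras `ψ : C → Hom_k(R, R')`. -/
structure IsMeasuring {R R' : Type*} [Ring R] [Algebra k R] [Ring R'] [Algebra k R']
    (ψ : C →ₗ[k] R →ₗ[k] R') : Prop where
  map_mul : ∀ x a b, ψ x (a * b) = sweedler (LinearMap.mul k R') ψ ψ x a b
  map_one : ∀ x, ψ x 1 = Coalgebra.counit (R := k) x • (1 : R')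

end Measuring

/-- A pair of measurings `Ψ : C → Hom_k(U, U')`, `ψ : C → Hom_k(A, A')` compatible with the source and
target maps, the counits and the antipodes. -/
structure PreMeasuring.{u, u', v, w} {k : Type v} [Field k] {A U : Type u} {A' U' : Type u'} [Ring A]
    [Algebra k A] [Ring U] [Algebra k U] [Ring A'] [Algebra k A'] [Ring U'] [Algebra k U']
    (C : Type w) [AddCommGroup C] [Module k C] [Coalgebra k C]
    (H : HopfAlgebroid k A U) (H' : HopfAlgebroid k A' U') where
  /-- the measuring of total algebras -/
  Ψ : C →ₗ[k] U →ₗ[k] U'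
  /-- the measuring of base algebras -/
  ψ : C →ₗ[k] A →ₗ[k] A'
  isMeasuring_Ψ : IsMeasuring Ψ
  isMeasuring_ψ : IsMeasuring ψ
  map_s : ∀ x a, Ψ x (H.s a) = H'.s (ψ x a)
  map_t : ∀ x a, Ψ x (H.t (op a)) = H'.t (op (ψ x a))
  map_S : ∀ x u, Ψ x (H.S u) = H'.S (Ψ x u)
  map_ε : ∀ x u, ψ x (H.ε u) = H'.ε (Ψ x u)

namespace PreMeasuring

universe u u' v w
variable {k : Type v} [Field k] {A U : Type u} {A' U' : Type u'} [Ring A]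
    [Algebra k A] [Ring U] [Algebra k U] [Ring A'] [Algebra k A'] [Ring U'] [Algebra k U']
    {C : Type w} [AddCommGroup C] [Module k C] [Coalgebra k C]
    {H : HopfAlgebroid k A U} {H' : HopfAlgebroid k A' U'} (Φ : PreMeasuring C H H')

/-- `g : C → Hom_k(M, M')` is compatible with `ψ` if `g x (a · m) = ψ x₁ a · g x₂ m`. -/
def Compat {M : LeftMod k A} {M' : LeftMod k A'} (g : C →ₗ[k] M →ₗ[k] M') : Prop :=
  ∀ x a m, g x (M.act a m) = sweedler M'.act.toLinearMap Φ.ψ g x a m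

lemma compat_self : Φ.Compat (M := H.self) (M' := H'.self) Φ.Ψ := by
  intro x a v
  change Φ.Ψ x (H.s a * (v : U)) = sweedlerAux (H'.self).act.toLinearMap Φ.ψ Φ.Ψ (Coalgebra.comul x) a v
  rw [Φ.isMeasuring_Ψ.map_mul]
  change sweedlerAux _ _ _ (Coalgebra.comul x) (H.s a) v = _
  generalize (Coalgebra.comul (R := k) x) = y
  induction y using TensorProduct.induction_on with
  | zero => simp
  | tmul c d =>
    rw [sweedlerAux_tmul, Φ.map_s]
    exact (sweedlerAux_tmul (W := U) (W' := U') (N := U') (H'.self).act.toLinearMap Φ.ψ Φ.Ψ c d a v).symm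
  | add y z hy hz => rw [map_add, map_add]; exact congrArg₂ (· + ·) hy hz

lemma compat_unit : Φ.Compat (M := LeftMod.unit k A) (M' := LeftMod.unit k A') Φ.ψ :=
  fun x a b => Φ.isMeasuring_ψ.map_mul x a b

/-- The map `x ↦ (u ⊗ m ↦ x₁(u) ⊗ g x₂ m)` is balanced over `A`, as `C` is cocommutative. -/
lemma sweedler_balanced [Coalgebra.IsCocomm k C] {M : LeftMod k A} {M' : LeftMod k A'}
    (g : C →ₗ[k] M →ₗ[k] M') (hg : Φ.Compat g) (x : C) (a : A) (u : U) (m : M) :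
    sweedler (H'.tmul M') Φ.Ψ g x (H.t (op a) * u) m =
      sweedler (H'.tmul M') Φ.Ψ g x u (M.act a m) := by
  let T : C ⊗[k] (C ⊗[k] C) →ₗ[k] H'.Tens M' :=
    (TensorProduct.lift (H'.tmul M')).comp (TensorProduct.map (Φ.Ψ.flip u)
      ((TensorProduct.lift M'.act.toLinearMap).comp
        (TensorProduct.map (Φ.ψ.flip a) (g.flip m))))
  have hT : ∀ q p r, T (q ⊗ₜ (p ⊗ₜ r)) = H'.tmul M' (Φ.Ψ q u) (M'.act (Φ.ψ p a) (g r m)) :=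
    fun _ _ _ => rfl
  have h1 : ∀ y, sweedlerAux (H'.tmul M') Φ.Ψ g y u (M.act a m) =
      T (Coalgebra.comul.lTensor C y) := by
    intro y
    induction y using TensorProduct.induction_on with
    | zero => simp
    | tmul c d =>
      rw [sweedlerAux_tmul, LinearMap.lTensor_tmul, hg d a m]
      change H'.tmul M' (Φ.Ψ c u) (sweedlerAux _ _ _ (Coalgebra.comul d) a m) = _
      generalize (Coalgebra.comul (R := k) d) = z
      induction z using TensorProduct.induction_on with
      | zero => simp
      | tmul p r => rw [sweedlerAux_tmul, hT]; rfl
      | add z z' hz hz' => simp only [map_add, LinearMap.add_apply, TensorProduct.tmul_add, hz, hz']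
    | add y z hy hz => simp only [map_add, LinearMap.add_apply, hy, hz]
  have h2 : ∀ y, sweedlerAux (H'.tmul M') Φ.Ψ g y (H.t (op a) * u) m =
      T (TensorProduct.assoc k C C C ((TensorProduct.comm k C C).toLinearMap.rTensor C
        (Coalgebra.comul.rTensor C y))) := by
    intro y
    induction y using TensorProduct.induction_on with
    | zero => simp
    | tmul c d =>
      rw [sweedlerAux_tmul, LinearMap.rTensor_tmul, Φ.isMeasuring_Ψ.map_mul]
      change H'.tmul M' (sweedlerAux _ _ _ (Coalgebra.comul c) _ u) _ = _
      generalize (Coalgebra.comul (R := k) c) = z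
      induction z using TensorProduct.induction_on with
      | zero => simp
      | tmul p q =>
        rw [sweedlerAux_tmul, Φ.map_t, LinearMap.mul_apply', H'.tmul_act]
        rfl
      | add z z' hz hz' => simp only [map_add, LinearMap.add_apply, TensorProduct.add_tmul, hz, hz']
    | add y z hy hz => simp only [map_add, LinearMap.add_apply, hy, hz]
  refine (h2 _).trans ((congrArg T ?_).trans (h1 _).symm)
  rw [← LinearMap.comp_apply, ← LinearMap.rTensor_comp, Coalgebra.comm_comp_comul]
  exact Coalgebra.coassoc_apply x

/-- The action `x(u ⊗ m) = x₁(u) ⊗ g x₂ m` of `C` on tensor products. -/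
def tensMap [Coalgebra.IsCocomm k C] {M : LeftMod k A} {M' : LeftMod k A'}
    (g : C →ₗ[k] M →ₗ[k] M') (hg : Φ.Compat g) : C →ₗ[k] H.Tens M →ₗ[k] H'.Tens M' where
  toFun x := H.lift (sweedler (H'.tmul M') Φ.Ψ g x) (Φ.sweedler_balanced g hg x)
  map_add' x y := H.tensor_ext fun u m => by
    rw [LinearMap.add_apply, H.lift_tmul, H.lift_tmul, H.lift_tmul, map_add]; rfl
  map_smul' c x := H.tensor_ext fun u m => by
    rw [LinearMap.smul_apply, H.lift_tmul, H.lift_tmul, map_smul]; rfl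

lemma tensMap_tmul [Coalgebra.IsCocomm k C] {M : LeftMod k A} {M' : LeftMod k A'}
    (g : C →ₗ[k] M →ₗ[k] M') (hg : Φ.Compat g) (x : C) (u : U) (m : M) :
    Φ.tensMap g hg x (H.tmul M u m) = sweedler (H'.tmul M') Φ.Ψ g x u m :=
  H.lift_tmul _ (Φ.sweedler_balanced g hg x) u m

lemma compat_tensMap [Coalgebra.IsCocomm k C] {M : LeftMod k A} {M' : LeftMod k A'}
    (g : C →ₗ[k] M →ₗ[k] M') (hg : Φ.Compat g) :
    Φ.Compat (M := H.tens M) (M' := H'.tens M') (Φ.tensMap g hg) := by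
  intro x a
  refine LinearMap.congr_fun (H.tensor_ext (M := M)
    (f := (Φ.tensMap g hg x).comp ((H.tens M).act a))
    (g := sweedler (H'.tens M').act.toLinearMap Φ.ψ (Φ.tensMap g hg) x a) fun u m => ?_)
  rw [LinearMap.comp_apply, H.tensActHom_tmul, Φ.tensMap_tmul]
  let T : C ⊗[k] (C ⊗[k] C) →ₗ[k] H'.Tens M' :=
    (TensorProduct.lift (H'.tens M').act.toLinearMap).comp (TensorProduct.map (Φ.ψ.flip a)
      ((TensorProduct.lift (H'.tmul M')).comp (TensorProduct.map (Φ.Ψ.flip u) (g.flip m))))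
  have hT : ∀ p q r, T (p ⊗ₜ (q ⊗ₜ r)) =
      (H'.tens M').act (Φ.ψ p a) (H'.tmul M' (Φ.Ψ q u) (g r m)) :=
    fun _ _ _ => rfl
  have h1 : ∀ y, sweedlerAux (H'.tens M').act.toLinearMap Φ.ψ (Φ.tensMap g hg) y a
      (H.tmul M u m) = T (Coalgebra.comul.lTensor C y) := by
    intro y
    induction y using TensorProduct.induction_on with
    | zero => simp
    | tmul c d =>
      rw [sweedlerAux_tmul, LinearMap.lTensor_tmul, Φ.tensMap_tmul]
      change (H'.tens M').act (Φ.ψ c a) (sweedlerAux _ _ _ (Coalgebra.comul d) u m) = _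
      generalize (Coalgebra.comul (R := k) d) = z
      induction z using TensorProduct.induction_on with
      | zero => simp
      | tmul p r => rw [sweedlerAux_tmul, hT]
      | add z z' hz hz' => simp only [map_add, LinearMap.add_apply, TensorProduct.tmul_add, hz, hz']
    | add y z hy hz => simp only [map_add, LinearMap.add_apply, hy, hz]
  have h2 : ∀ y, sweedlerAux (H'.tmul M') Φ.Ψ g y (H.s a * u) m =
      T (TensorProduct.assoc k C C C (Coalgebra.comul.rTensor C y)) := by
    intro y
    induction y using TensorProduct.induction_on with
    | zero => simp
    | tmul c d =>
      rw [sweedlerAux_tmul, LinearMap.rTensor_tmul, Φ.isMeasuring_Ψ.map_mul]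
      change H'.tmul M' (sweedlerAux _ _ _ (Coalgebra.comul c) _ u) _ = _
      generalize (Coalgebra.comul (R := k) c) = z
      induction z using TensorProduct.induction_on with
      | zero => simp
      | tmul p q =>
        rw [sweedlerAux_tmul, Φ.map_s, LinearMap.mul_apply', TensorProduct.assoc_tmul, hT,
          H'.tensActHom_tmul]
      | add z z' hz hz' => simp only [map_add, LinearMap.add_apply, TensorProduct.add_tmul, hz, hz']
    | add y z hy hz => simp only [map_add, LinearMap.add_apply, hy, hz]
  refine (h2 _).trans ((congrArg T ?_).trans (h1 _).symm)
  exact Coalgebra.coassoc_apply x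

/-- The action of `C` on cochains, bundled with its compatibility with `ψ`. -/
def cochainAux [Coalgebra.IsCocomm k C] (n : ℕ) :
    {g : C →ₗ[k] H.cochain n →ₗ[k] H'.cochain n // Φ.Compat g} :=
  match n with
  | 0 => ⟨Φ.ψ, Φ.compat_unit⟩
  | n + 1 => ⟨Φ.tensMap (cochainAux n).1 (cochainAux n).2, Φ.compat_tensMap _ _⟩

/-- The map `Cⁿ(U) → Cⁿ(U')`, `u¹ ⊗ ⋯ ⊗ uⁿ ↦ x₁(u¹) ⊗ ⋯ ⊗ xₙ(uⁿ)`, given by `x` in `C`; for `n = 0` it is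
`ψ x : A → A'`. -/
def onCochain [Coalgebra.IsCocomm k C] (n : ℕ) : C →ₗ[k] H.cochain n →ₗ[k] H'.cochain n :=
  (Φ.cochainAux n).1

lemma onCochain_base [Coalgebra.IsCocomm k C] (x : C) (a : A) :
    Φ.onCochain 0 x (H.base a) = H'.base (Φ.ψ x a) := rfl

lemma onCochain_cons [Coalgebra.IsCocomm k C] (n : ℕ) (x : C) (u : U) (w : H.cochain n) :
    Φ.onCochain (n + 1) x (H.cons n u w) = sweedler (H'.cons n) Φ.Ψ (Φ.onCochain n) x u w :=
  Φ.tensMap_tmul _ (Φ.cochainAux n).2 x u w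

end PreMeasuring

/-- A measuring `(Ψ, ψ)` of Hopf algebroids by a cocommutative coalgebra `C`. -/
structure HopfMeasuring.{u, u', v, w} {k : Type v} [Field k] {A U : Type u} {A' U' : Type u'} [Ring A]
    [Algebra k A] [Ring U] [Algebra k U] [Ring A'] [Algebra k A'] [Ring U'] [Algebra k U']
    (C : Type w) [AddCommGroup C] [Module k C] [Coalgebra k C] [Coalgebra.IsCocomm k C]
    (H : HopfAlgebroid k A U) (H' : HopfAlgebroid k A' U') extends PreMeasuring C H H' where
  /-- `Δ'(x(u)) = x(Δ(u))`, with `x(u ⊗ v) = x₁(u) ⊗ x₂(v)`. -/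
  map_Δ : ∀ x u, H'.Δ (Ψ x u) = toPreMeasuring.tensMap (M := H.self) (M' := H'.self) Ψ
    toPreMeasuring.compat_self x (H.Δ u)

universe u u'

/-! ### Convolution of linear maps out of a coalgebra, along a bilinear map. -/

section ConvolutionAlong

universe v w
variable {k : Type v} [Field k] {C : Type w} [AddCommGroup C] [Module k C] [Coalgebra k C]
variable {V V' W W' N P Q : Type*} [AddCommGroup V] [Module k V] [AddCommGroup V'] [Module k V']
  [AddCommGroup W] [Module k W] [AddCommGroup W'] [Module k W'] [AddCommGroup N] [Module k N]
  [AddCommGroup P] [Module k P] [AddCommGroup Q] [Module k Q]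

/-! Fix an element of a source space and let `x` vary: each `u` in `U` gives a linear map `Φ.Ψ.flip
u : C → U'`, and each cochain `w` a linear map `(Φ.onCochain n).flip w : C → Cⁿ(U')`. The action on
`u ⊗ w` is the convolution of the maps of `u` and `w` along `⊗`, and the measuring axioms say that
`u ↦ Φ.Ψ.flip u` is an algebra map into the convolution algebra `Hom(C, U')`. Commuting with an
operator thus becomes an equality of linear maps out of `C`, in which no Sweedler component of `x`
appears.

Such equalities follow from a few rules for convolutions. Naturality (`convAlong_comp_comp`,
`comp_convAlong`) moves linear operations in and out, the counit rules absorb units,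
`convAlong_assoc` expresses coassociativity, and `convAlong_medial`, the interchange of the two
middle factors, expresses cocommutativity. What remains after applying them is an identity in the
target algebroid alone.

The cochain spaces are iterated tensor products `U ⊗_A (U ⊗_A ⋯)`, so cofaces and codegeneracies are
treated by peeling off first factors. An operation on the first factor uses compatibility with `Δ`
or with `ε`; a later one passes to the tail; the last coface descends to degree zero, where it is
the source map.

The cyclic operator is the essential case. Since `τ (u ⊗ w) = S(u) · (w ⊗ 1)` for the diagonal
action of `U`, and `w ⊗ 1` is the last coface of `w`, it suffices that the measuring respects the
diagonal action: `x(g · w) = x₁(g) · x₂(w)`. This is `onCochain_flip_ρ`, an induction on the degree.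
In degree zero `g · a = ε(g s(a))`, so the compatibilities with `s`, `ε` and products are enough. In
the inductive step `g · (u ⊗ w) = g₁ u ⊗ g₂ w`; the measuring of `Δ(g)` is known, and the
interchange rule separates the components acting on `g` from those acting on `u ⊗ w`.

The statements on cohomology are formal: the differentials of both complexes are built linearly from
cofaces and cyclic operators. -/

/-- The convolution `x ↦ β (F x₁) (G x₂)` of `F : C → V` and `G : C → W` along a bilinear map `β`. -/
def convAlong (β : V →ₗ[k] W →ₗ[k] N) (F : C →ₗ[k] V) (G : C →ₗ[k] W) : C →ₗ[k] N :=
  TensorProduct.lift β ∘ₗ TensorProduct.map F G ∘ₗ Coalgebra.comul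

/-- Translates Sweedler expressions, where `x` comes first, into convolutions, where `x` is the
variable and can be removed by extensionality. -/
lemma sweedler_eq_convAlong (β : V' →ₗ[k] W' →ₗ[k] N) (f : C →ₗ[k] V →ₗ[k] V')
    (g : C →ₗ[k] W →ₗ[k] W') (x : C) (p : V) (q : W) :
    sweedler β f g x p q = convAlong β (f.flip p) (g.flip q) x := by
  change sweedlerAux β f g (Coalgebra.comul x) p q =
    TensorProduct.lift β (TensorProduct.map (f.flip p) (g.flip q) (Coalgebra.comul x))
  generalize Coalgebra.comul (R := k) x = y
  induction y using TensorProduct.induction_on with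
  | zero => simp
  | tmul c d => simp
  | add y z hy hz => simp only [map_add, LinearMap.add_apply, hy, hz]

/-- Naturality in both arguments. The hypothesis is pointwise, so that an application leaves only an
identity between elements, with `C` gone. -/
lemma convAlong_comp_comp (β : V' →ₗ[k] W' →ₗ[k] N) (γ : V →ₗ[k] W →ₗ[k] N) (f : V →ₗ[k] V')
    (g : W →ₗ[k] W') (h : ∀ a b, β (f a) (g b) = γ a b) (F : C →ₗ[k] V) (G : C →ₗ[k] W) :
    convAlong β (f ∘ₗ F) (g ∘ₗ G) = convAlong γ F G := by
  have e : γ = β.compl₁₂ f g := by ext a b; exact (h a b).symm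
  rw [e, convAlong, TensorProduct.map_comp, convAlong, LinearMap.comp_assoc,
    ← LinearMap.comp_assoc _ _ (TensorProduct.lift β)]
  congr 1
  ext; rfl

lemma convAlong_comp_left {β : V' →ₗ[k] W →ₗ[k] N} {γ : V →ₗ[k] W →ₗ[k] N} {f : V →ₗ[k] V'}
    (h : ∀ a b, β (f a) b = γ a b) (F : C →ₗ[k] V) (G : C →ₗ[k] W) :
    convAlong β (f ∘ₗ F) G = convAlong γ F G :=
  convAlong_comp_comp β γ f LinearMap.id h F G

lemma convAlong_comp_right {β : V →ₗ[k] W' →ₗ[k] N} {γ : V →ₗ[k] W →ₗ[k] N} {g : W →ₗ[k] W'}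
    (h : ∀ a b, β a (g b) = γ a b) (F : C →ₗ[k] V) (G : C →ₗ[k] W) :
    convAlong β F (g ∘ₗ G) = convAlong γ F G :=
  convAlong_comp_comp β γ LinearMap.id g h F G

lemma comp_convAlong (β : V →ₗ[k] W →ₗ[k] N) (f : N →ₗ[k] P) (F : C →ₗ[k] V) (G : C →ₗ[k] W) :
    f ∘ₗ convAlong β F G = convAlong (β.compr₂ f) F G := by
  rw [convAlong, ← LinearMap.comp_assoc, convAlong]
  congr 1
  ext; rfl

/-- The counit axiom `ε(x₁) x₂ = x`: a factor on which `C` acts through its counit uses up no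
Sweedler component. -/
lemma convAlong_counit_left (β : V →ₗ[k] W →ₗ[k] N) (a : V) (G : C →ₗ[k] W) :
    convAlong β (Coalgebra.counit.smulRight a) G = β a ∘ₗ G := by
  ext x
  -- For arbitrary tensors the pairing factors through `ε ⊗ id`; only afterwards is the tensor
  -- specialised to the comultiplication of `x`.
  have h : ∀ y : C ⊗[k] C, TensorProduct.lift β (TensorProduct.map
      ((Coalgebra.counit (R := k)).smulRight a) G y) =
      TensorProduct.lift ((LinearMap.lsmul k N).compl₂ (β a ∘ₗ G))
        (Coalgebra.counit.rTensor C y) := by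
    intro y
    induction y using TensorProduct.induction_on with
    | zero => simp
    | tmul c d => simp
    | add y z hy hz => simp only [map_add, hy, hz]
  refine (h _).trans ?_
  rw [Coalgebra.rTensor_counit_comul]
  simp

lemma convAlong_counit_right (β : V →ₗ[k] W →ₗ[k] N) (F : C →ₗ[k] V) (b : W) :
    convAlong β F (Coalgebra.counit.smulRight b) = β.flip b ∘ₗ F := by
  ext x
  have h : ∀ y : C ⊗[k] C, TensorProduct.lift β (TensorProduct.map F
      ((Coalgebra.counit (R := k)).smulRight b) y) =
      TensorProduct.lift ((LinearMap.lsmul k N).compl₂ (β.flip b ∘ₗ F)).flip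
        (Coalgebra.counit.lTensor C y) := by
    intro y
    induction y using TensorProduct.induction_on with
    | zero => simp
    | tmul c d => simp
    | add y z hy hz => simp only [map_add, hy, hz]
  refine (h _).trans ?_
  rw [Coalgebra.lTensor_counit_comul]
  simp

/-- Coassociativity: both sides apply one trilinear map to `F x₁`, `G x₂`, `K x₃`. The statements
`h1` and `h2` exhibit it, with the two bracketings of the iterated comultiplication as the only
difference. -/
lemma convAlong_assoc {β : P →ₗ[k] W' →ₗ[k] N} {γ : V →ₗ[k] W →ₗ[k] P} {β' : V →ₗ[k] Q →ₗ[k] N}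
    {γ' : W →ₗ[k] W' →ₗ[k] Q} (h : ∀ a b c, β (γ a b) c = β' a (γ' b c))
    (F : C →ₗ[k] V) (G : C →ₗ[k] W) (K : C →ₗ[k] W') :
    convAlong β (convAlong γ F G) K = convAlong β' F (convAlong γ' G K) := by
  ext x
  have h1 : ∀ y : C ⊗[k] C, TensorProduct.lift β (TensorProduct.map (convAlong γ F G) K y) =
      TensorProduct.lift β' ((TensorProduct.lift γ').lTensor V
        (TensorProduct.map F (TensorProduct.map G K)
          (TensorProduct.assoc k C C C (Coalgebra.comul.rTensor C y)))) := by
    intro y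
    induction y using TensorProduct.induction_on with
    | zero => simp
    | tmul c d =>
      rw [TensorProduct.map_tmul, LinearMap.rTensor_tmul, convAlong]
      simp only [LinearMap.comp_apply]
      generalize Coalgebra.comul (R := k) c = z
      induction z using TensorProduct.induction_on with
      | zero => simp
      | tmul p r => simp [h]
      | add z z' hz hz' => simp only [map_add, TensorProduct.add_tmul, hz, hz']
    | add y z hy hz => simp only [map_add, hy, hz]
  have h2 : ∀ y : C ⊗[k] C, TensorProduct.lift β' (TensorProduct.map F (convAlong γ' G K) y) =
      TensorProduct.lift β' ((TensorProduct.lift γ').lTensor V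
        (TensorProduct.map F (TensorProduct.map G K) (Coalgebra.comul.lTensor C y))) := by
    intro y
    induction y using TensorProduct.induction_on with
    | zero => simp
    | tmul c d => simp [convAlong]
    | add y z hy hz => simp only [map_add, hy, hz]
  refine (h1 _).trans (Eq.trans ?_ (h2 _).symm)
  rw [Coalgebra.coassoc_apply]

/-- Cocommutativity in the form `x₁ ⊗ x₂ ⊗ x₃ ⊗ x₄ = x₁ ⊗ x₃ ⊗ x₂ ⊗ x₄`. This holds because the
comultiplication of a cocommutative coalgebra is itself a coalgebra morphism. -/
lemma convAlong_medial [Coalgebra.IsCocomm k C] {β : P →ₗ[k] Q →ₗ[k] N} {γ : V →ₗ[k] W →ₗ[k] P}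
    {δ : V' →ₗ[k] W' →ₗ[k] Q} {P' Q' : Type*} [AddCommGroup P'] [Module k P'] [AddCommGroup Q']
    [Module k Q'] {β' : P' →ₗ[k] Q' →ₗ[k] N} {γ' : V →ₗ[k] V' →ₗ[k] P'} {δ' : W →ₗ[k] W' →ₗ[k] Q'}
    (h : ∀ a b c d, β (γ a b) (δ c d) = β' (γ' a c) (δ' b d))
    (F : C →ₗ[k] V) (G : C →ₗ[k] W) (K : C →ₗ[k] V') (L : C →ₗ[k] W') :
    convAlong β (convAlong γ F G) (convAlong δ K L) =
      convAlong β' (convAlong γ' F K) (convAlong δ' G L) := by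
  have e : TensorProduct.map Coalgebra.comul Coalgebra.comul ∘ₗ Coalgebra.comul (R := k) (A := C) =
      (TensorProduct.tensorTensorTensorComm k C C C C).toLinearMap ∘ₗ
        TensorProduct.map Coalgebra.comul Coalgebra.comul ∘ₗ Coalgebra.comul :=
    (Coalgebra.comulCoalgHom k C).map_comp_comul
  simp only [convAlong, TensorProduct.map_comp, LinearMap.comp_assoc]
  -- Both sides contain the same iterated comultiplication; inserting the middle swap on one side
  -- only makes the remaining multilinear maps agree by `h`.
  conv_rhs => rw [e]
  simp only [← LinearMap.comp_assoc]
  congr 2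
  ext a b c d
  simp [h]

end ConvolutionAlong

/-! ### Measurings as convolution identities. -/

namespace PreMeasuring

universe v w
variable {k : Type v} [Field k] {A U : Type u} {A' U' : Type u'} [Ring A]
    [Algebra k A] [Ring U] [Algebra k U] [Ring A'] [Algebra k A'] [Ring U'] [Algebra k U']
    {C : Type w} [AddCommGroup C] [Module k C] [Coalgebra k C]
    {H : HopfAlgebroid k A U} {H' : HopfAlgebroid k A' U'} (Φ : PreMeasuring C H H')

/-- Together with `Ψ_flip_one`: a measuring is an algebra map from `U` to the convolution algebra
`Hom(C, U')`, whose unit is the counit of `C` times `1`. -/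
lemma Ψ_flip_mul (u v : U) :
    Φ.Ψ.flip (u * v) = convAlong (LinearMap.mul k U') (Φ.Ψ.flip u) (Φ.Ψ.flip v) := by
  ext x
  exact (Φ.isMeasuring_Ψ.map_mul x u v).trans (sweedler_eq_convAlong _ _ _ _ _ _)

lemma Ψ_flip_one : Φ.Ψ.flip 1 = Coalgebra.counit.smulRight 1 := by
  ext x
  exact Φ.isMeasuring_Ψ.map_one x

variable [Coalgebra.IsCocomm k C]

/-- The action of `C` on `U ⊗_A U`. -/
def onTens : C →ₗ[k] H.Tens H.self →ₗ[k] H'.Tens H'.self :=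
  Φ.tensMap (M := H.self) (M' := H'.self) Φ.Ψ Φ.compat_self

lemma onTens_flip_tmul (u v : U) :
    Φ.onTens.flip (H.tmul H.self u v) =
      convAlong (W := U') (H'.tmul H'.self) (Φ.Ψ.flip u) (Φ.Ψ.flip v) := by
  ext x
  exact (Φ.tensMap_tmul (M := H.self) (M' := H'.self) Φ.Ψ Φ.compat_self x u v).trans
    (sweedler_eq_convAlong (W := U) (W' := U') _ _ _ _ _ _)

lemma onCochain_flip_cons (n : ℕ) (u : U) (w : H.cochain n) :
    (Φ.onCochain (n + 1)).flip (H.cons n u w) =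
      convAlong (H'.cons n) (Φ.Ψ.flip u) ((Φ.onCochain n).flip w) := by
  ext x
  exact (Φ.onCochain_cons n x u w).trans (sweedler_eq_convAlong _ _ _ _ _ _)

/-- This is the compatibility that the recursive construction carries along with the maps on
cochains. It is needed for codegeneracies, where `ε(u)` acts on the remaining factors. -/
lemma onCochain_flip_act (n : ℕ) (a : A) (w : H.cochain n) :
    (Φ.onCochain n).flip ((H.cochain n).act a w) =
      convAlong (H'.cochain n).act.toLinearMap (Φ.ψ.flip a) ((Φ.onCochain n).flip w) := by
  ext x
  exact ((Φ.cochainAux n).2 x a w).trans (sweedler_eq_convAlong _ _ _ _ _ _)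

lemma onCochain_flip_base (a : A) :
    (Φ.onCochain 0).flip (H.base a) = H'.base ∘ₗ Φ.ψ.flip a := rfl

/-- The trailing `1` that closes a tensor `u¹ ⊗ (⋯ (uⁿ ⊗ 1))` is acted on through the counit, so by
`convAlong_counit_right` it takes no component of `x`. -/
lemma onCochain_flip_base_one :
    (Φ.onCochain 0).flip (H.base 1) = Coalgebra.counit.smulRight (H'.base 1) := by
  ext x
  rw [onCochain_flip_base]
  change H'.base (Φ.ψ x 1) = _
  rw [Φ.isMeasuring_ψ.map_one, map_smul]
  rfl

/-- Elements such as `Δ(u)` are not pure tensors, but both sides are linear in `z`, so checking `p ⊗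
q` suffices. The map `T` bundles the right side as a linear map in `z`. -/
lemma flip_onTens_eq_convAlong {N N' Q : Type*} [AddCommGroup N] [Module k N] [AddCommGroup N']
    [Module k N'] [AddCommGroup Q] [Module k Q] (f : H.Tens H.self →ₗ[k] N)
    (g : C →ₗ[k] N →ₗ[k] N') (β : H'.Tens H'.self →ₗ[k] Q →ₗ[k] N') (K : C →ₗ[k] Q)
    (h : ∀ p q : U, g.flip (f (H.tmul H.self p q)) =
      convAlong β (Φ.onTens.flip (H.tmul H.self p q)) K)
    (z : H.Tens H.self) : g.flip (f z) = convAlong β (Φ.onTens.flip z) K := by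
  let T : H.Tens H.self →ₗ[k] C →ₗ[k] N' :=
    { toFun := fun z => convAlong β (Φ.onTens.flip z) K
      map_add' := fun y z => by
        simp only [convAlong, map_add, TensorProduct.map_add_left, LinearMap.add_comp,
          LinearMap.comp_add]
      map_smul' := fun c z => by
        simp only [convAlong, map_smul, TensorProduct.map_smul_left, LinearMap.smul_comp,
          LinearMap.comp_smul, RingHom.id_apply] }
  exact LinearMap.congr_fun (H.tensor_ext (M := H.self) (f := g.flip ∘ₗ f) (g := T) h) z

end PreMeasuring

/-! ### Bilinear forms of the tensor operations, along which one can convolve. -/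

namespace BialgebroidData

universe v
variable {k : Type v} {A U : Type u} [Field k] [Ring A] [Algebra k A] [Ring U] [Algebra k U]
variable (B : BialgebroidData k A U)

/-- `(p ⊗ q, w) ↦ p ⊗ q ⊗ w`, bilinearly. -/
def consTwoBilin (n : ℕ) : B.Tens B.self →ₗ[k] B.cochain n →ₗ[k] B.cochain (n + 1 + 1) :=
  B.lift (M := B.self) ((LinearMap.llcomp k _ _ _).compl₁₂ (B.cons (n + 1)) (B.cons n)) (by
    intro a p q
    ext w
    change B.cons (n + 1) (B.t (op a) * p) (B.cons n q w) =
      B.cons (n + 1) p (B.cons n (B.s a * (q : U)) w)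
    rw [B.cons_act, B.act_cons])

lemma consTwoBilin_tmul (n : ℕ) (p q : U) (w : B.cochain n) :
    B.consTwoBilin n (B.tmul B.self p q) w = B.cons (n + 1) p (B.cons n q w) :=
  LinearMap.congr_fun (B.lift_tmul (M := B.self) _ _ p q) w

lemma consTwoBilin_apply (n : ℕ) (z : B.Tens B.self) (w : B.cochain n) :
    B.consTwoBilin n z w = B.consTwo n w z :=
  LinearMap.congr_fun (B.tensor_ext (M := B.self) (f := (B.consTwoBilin n).flip w)
    (g := B.consTwo n w) fun p (q : U) => by
      rw [LinearMap.flip_apply, B.consTwoBilin_tmul, B.consTwo_tmul]) z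

end BialgebroidData

namespace LeftBialgebroid

universe v
variable {k : Type v} {A U : Type u} [Field k] [Ring A] [Algebra k A] [Ring U] [Algebra k U]
variable (B : LeftBialgebroid k A U)

/-- `(x ⊗ y, u ⊗ w) ↦ x u ⊗ y w`, bilinearly. -/
def mulCTensor (n : ℕ) :
    B.Tens B.self →ₗ[k] U ⊗[k] B.cochain n →ₗ[k] B.cochain (n + 1) :=
  (TensorProduct.lift.equiv (RingHom.id k) U (B.cochain n) (B.cochain (n + 1))).toLinearMap ∘ₗ
    B.mulC n

end LeftBialgebroid

/-! ### Compatibility of a measuring with cofaces, codegeneracies and cyclic operators. -/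

namespace HopfMeasuring

universe v w
variable {k : Type v} [Field k] {A U : Type u} {A' U' : Type u'} [Ring A]
    [Algebra k A] [Ring U] [Algebra k U] [Ring A'] [Algebra k A'] [Ring U'] [Algebra k U']
    {C : Type w} [AddCommGroup C] [Module k C] [Coalgebra k C] [Coalgebra.IsCocomm k C]
    {H : HopfAlgebroid k A U} {H' : HopfAlgebroid k A' U'} (Φ : HopfMeasuring C H H')

lemma onTens_flip_Δ (u : U) : Φ.onTens.flip (H.Δ u) = H'.Δ ∘ₗ Φ.Ψ.flip u := by
  ext x
  exact (Φ.map_Δ x u).symm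

/-- Reassociates `p ⊗ (q ⊗ w)` as `(p ⊗ q) ⊗ w`, so that the first two factors can be replaced by
`Δ(u)` and the compatibility with `Δ` applied to them. -/
lemma onCochain_flip_consTwo (n : ℕ) (w : H.cochain n) (z : H.Tens H.self) :
    (Φ.onCochain (n + 1 + 1)).flip (H.consTwo n w z) =
      convAlong (H'.consTwoBilin n) (Φ.onTens.flip z) ((Φ.onCochain n).flip w) := by
  refine Φ.flip_onTens_eq_convAlong (H.consTwo n w) _ _ _ (fun p q => ?_) z
  rw [H.consTwo_tmul, Φ.onCochain_flip_cons, Φ.onCochain_flip_cons, Φ.onTens_flip_tmul]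
  exact (convAlong_assoc (fun a b c => H'.consTwoBilin_tmul n a b c) _ _ _).symm

lemma onCochain_flip_coface_zero (n : ℕ) (w : H.cochain n) :
    (Φ.onCochain (n + 1)).flip (H.coface n 0 w) = H'.coface n 0 ∘ₗ (Φ.onCochain n).flip w := by
  rw [H.coface_zero, Φ.onCochain_flip_cons, Φ.Ψ_flip_one, convAlong_counit_left]
  rfl

lemma onCochain_flip_coface_succ : ∀ (n i : ℕ) (w : H.cochain n), i ≤ n →
    (Φ.onCochain (n + 1)).flip (H.coface n (i + 1) w) =
      H'.coface n (i + 1) ∘ₗ (Φ.onCochain n).flip w := by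
  intro n
  induction n with
  | zero =>
    -- In degree zero the coface is `a ↦ s(a) ⊗ 1`. The last coface of every degree descends to this
    -- case, so it rests on compatibility with the source map.
    intro i a _
    obtain ⟨a, ha⟩ := H.exists_base a
    rw [ha, H.coface_base, Φ.onCochain_flip_cons, Φ.onCochain_flip_base_one,
      Φ.onCochain_flip_base]
    have e : Φ.Ψ.flip (H.s a) = H'.s.toLinearMap ∘ₗ Φ.ψ.flip a := by
      ext x
      exact Φ.map_s x a
    rw [convAlong_counit_right, e]
    ext x
    exact (H'.coface_base i (Φ.ψ x a)).symm
  | succ n ih =>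
    intro i w hi
    induction w using H.cochain_induction with
    | hadd x y hx hy => simp only [map_add, LinearMap.comp_add, hx, hy]
    | h u w =>
      rw [Φ.onCochain_flip_cons, comp_convAlong]
      -- Either `Δ` hits the first factor, or the coface acts on the tail and the induction
      -- hypothesis applies.
      rcases i with _ | i
      · rw [H.coface_one, Φ.onCochain_flip_consTwo, Φ.onTens_flip_Δ]
        refine convAlong_comp_left (fun a b => ?_) _ _
        rw [H'.consTwoBilin_apply, LinearMap.compr₂_apply, H'.coface_one]
      · rw [H.coface_succ_succ, Φ.onCochain_flip_cons, ih i w (by omega)]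
        refine convAlong_comp_right (fun a b => ?_) _ _
        rw [LinearMap.compr₂_apply, H'.coface_succ_succ]

lemma onCochain_flip_coface (n i : ℕ) (hi : i ≤ n + 1) (w : H.cochain n) :
    (Φ.onCochain (n + 1)).flip (H.coface n i w) = H'.coface n i ∘ₗ (Φ.onCochain n).flip w := by
  rcases i with _ | i
  · exact Φ.onCochain_flip_coface_zero n w
  · exact Φ.onCochain_flip_coface_succ n i w (by omega)

lemma onCochain_flip_codeg : ∀ (n i : ℕ) (w : H.cochain (n + 1)), i ≤ n →
    (Φ.onCochain n).flip (H.codeg n i w) = H'.codeg n i ∘ₗ (Φ.onCochain (n + 1)).flip w := by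
  -- The case `i = 0` is proved for all degrees first: it serves as the base and recurs in the
  -- inductive step. Here `ε(u)` acts on the tail, so compatibility with `ε` combines with
  -- `onCochain_flip_act`.
  have h0 : ∀ (n : ℕ) (w : H.cochain (n + 1)),
      (Φ.onCochain n).flip (H.codeg n 0 w) = H'.codeg n 0 ∘ₗ (Φ.onCochain (n + 1)).flip w := by
    intro n w
    induction w using H.cochain_induction with
    | hadd x y hx hy => simp only [map_add, LinearMap.comp_add, hx, hy]
    | h u w =>
      have e : Φ.ψ.flip (H.ε u) = H'.ε ∘ₗ Φ.Ψ.flip u := by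
        ext x
        exact Φ.map_ε x u
      rw [H.codeg_zero, Φ.onCochain_flip_act, Φ.onCochain_flip_cons, comp_convAlong, e]
      refine convAlong_comp_left (fun a b => ?_) _ _
      rw [LinearMap.compr₂_apply, H'.codeg_zero]
      rfl
  intro n
  induction n with
  | zero =>
    intro i w hi
    obtain rfl : i = 0 := by omega
    exact h0 0 w
  | succ n ih =>
    intro i w hi
    rcases i with _ | i
    · exact h0 (n + 1) w
    · induction w using H.cochain_induction with
      | hadd x y hx hy => simp only [map_add, LinearMap.comp_add, hx, hy]
      | h u w =>
        rw [H.codeg_succ, Φ.onCochain_flip_cons, Φ.onCochain_flip_cons, ih i w (by omega),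
          comp_convAlong]
        refine convAlong_comp_right (fun a b => ?_) _ _
        rw [LinearMap.compr₂_apply, H'.codeg_succ]

/-- For `z = p ⊗ q` the action of `x` yields `x₁(p) x₂(u) ⊗ x₃(q) · x₄(w)`, and cocommutativity
swaps the middle components to give `(x₁(p) ⊗ x₂(q)) · (x₃(u) ⊗ x₄(w))`. The hypothesis `h` is the
compatibility with the diagonal action one degree lower, supplied by induction in
`onCochain_flip_ρ`. -/
lemma onCochain_flip_mulC (n : ℕ) (z : H.Tens H.self) (u : U) (w : H.cochain n)
    (h : ∀ g, (Φ.onCochain n).flip ((H.cochainAct n).ρ g w) =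
      convAlong (H'.cochainAct n).ρ.toLinearMap (Φ.Ψ.flip g) ((Φ.onCochain n).flip w)) :
    (Φ.onCochain (n + 1)).flip (H.mulC n z u w) =
      convAlong (H'.mulCTensor n) (Φ.onTens.flip z)
        (convAlong (TensorProduct.mk k _ _) (Φ.Ψ.flip u) ((Φ.onCochain n).flip w)) := by
  refine Φ.flip_onTens_eq_convAlong (((H.mulC n).flip u).flip w) _ _ _ (fun p q => ?_) z
  rw [LinearMap.flip_apply, LinearMap.flip_apply, H.mulC_tmul, Φ.onCochain_flip_cons,
    Φ.Ψ_flip_mul, h, Φ.onTens_flip_tmul]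
  refine convAlong_medial (fun a b c d => ?_) _ _ _ _
  exact (H'.mulC_tmul n a c b d).symm

/-- The heart of the proof: the measuring respects the diagonal action of `U`. The inductive step
combines compatibility with `Δ` and the interchange in `onCochain_flip_mulC`. -/
lemma onCochain_flip_ρ (n : ℕ) (g : U) (w : H.cochain n) :
    (Φ.onCochain n).flip ((H.cochainAct n).ρ g w) =
      convAlong (H'.cochainAct n).ρ.toLinearMap (Φ.Ψ.flip g) ((Φ.onCochain n).flip w) := by
  induction n generalizing g with
  | zero =>
    obtain ⟨a, ha⟩ := H.exists_base w
    have e : Φ.ψ.flip (H.ε (g * H.s a)) = H'.ε ∘ₗ Φ.Ψ.flip (g * H.s a) := by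
      ext x
      exact Φ.map_ε x _
    have e' : Φ.Ψ.flip (H.s a) = H'.s.toLinearMap ∘ₗ Φ.ψ.flip a := by
      ext x
      exact Φ.map_s x a
    rw [ha, H.act_base', Φ.onCochain_flip_base, Φ.onCochain_flip_base, e, Φ.Ψ_flip_mul, e',
      comp_convAlong, comp_convAlong]
    -- Both sides are convolutions along `(g, a) ↦ ε'(g s'(a))`, the action of `U'` on `A'`.
    trans convAlong ((((LinearMap.mul k U').compr₂ H'.ε).compr₂ H'.base).compl₂ H'.s.toLinearMap)
      (Φ.Ψ.flip g) (Φ.ψ.flip a)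
    · exact convAlong_comp_right (fun a b => rfl) _ _
    · exact (convAlong_comp_right (fun a b => rfl) _ _).symm
  | succ n ih =>
    induction w using H.cochain_induction with
    | hadd x y hx hy =>
      simp only [map_add, hx, hy, convAlong, TensorProduct.map_add_right, LinearMap.add_comp,
        LinearMap.comp_add]
    | h u w =>
      rw [H.act_cons', Φ.onCochain_flip_mulC n _ u w fun g => ih g w, Φ.onCochain_flip_cons,
        Φ.onTens_flip_Δ]
      -- Factoring through the tensor product over `k` gives both sides the same second argument,
      -- the convolution of the maps of `u` and `w` before passing to `⊗_A`.
      have e : H'.cons n = (TensorProduct.mk k _ _).compr₂ (TensorProduct.lift (H'.cons n)) := rfl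
      rw [e, ← comp_convAlong]
      trans convAlong (H'.mulCTensor n ∘ₗ H'.Δ) (Φ.Ψ.flip g)
        (convAlong (TensorProduct.mk k _ _) (Φ.Ψ.flip u) ((Φ.onCochain n).flip w))
      · exact convAlong_comp_left (fun a b => rfl) _ _
      · refine (convAlong_comp_right (fun a b => ?_) _ _).symm
        -- The remaining identity lives in the target only: on pure tensors it is the formula for
        -- the diagonal action.
        induction b using TensorProduct.induction_on with
        | zero => simp
        | tmul u w => exact H'.act_cons' n a u w
        | add y z hy hz => rw [map_add, map_add, map_add, hy, hz]

lemma onCochain_flip_cyc (n : ℕ) (w : H.cochain n) :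
    (Φ.onCochain n).flip (H.cyc n w) = H'.cyc n ∘ₗ (Φ.onCochain n).flip w := by
  rcases n with _ | n
  · rfl
  · induction w using H.cochain_induction with
    | hadd x y hx hy => simp only [map_add, LinearMap.comp_add, hx, hy]
    | h u w =>
      have e : Φ.Ψ.flip (H.S u) = H'.S ∘ₗ Φ.Ψ.flip u := by
        ext x
        exact Φ.map_S x u
      -- In `τ (u ⊗ w) = S(u) · (w ⊗ 1)` the element `w ⊗ 1` is read as the last coface of `w`,
      -- whose compatibility is already known.
      rw [H.cyc_cons, Φ.onCochain_flip_ρ, ← H.coface_last,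
        Φ.onCochain_flip_coface_succ n n w le_rfl, e, Φ.onCochain_flip_cons, comp_convAlong]
      refine convAlong_comp_comp _ _ _ _ (fun a b => ?_) _ _
      rw [LinearMap.compr₂_apply, H'.cyc_cons, ← H'.coface_last]
      rfl

/-- The morphism of cocyclic modules `C^•(U) → C^•(U')` given by an element of `C`. -/
def cocyclicHom (x : C) : H.cocyclic.Hom H'.cocyclic where
  app n := Φ.onCochain n x
  app_δ n i hi w := LinearMap.congr_fun (Φ.onCochain_flip_coface n i hi w) x
  app_σ n i hi w := LinearMap.congr_fun (Φ.onCochain_flip_codeg n i w hi) x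
  app_τ n w := LinearMap.congr_fun (Φ.onCochain_flip_cyc n w) x

end HopfMeasuring

/-! ### The map on cohomology induced by a cochain map. -/

section CohomologyMap

universe v
variable {k : Type v} [Field k] {Y : ℕ → Type u} [∀ n, AddCommGroup (Y n)] [∀ n, Module k (Y n)]
  {Y' : ℕ → Type u'} [∀ n, AddCommGroup (Y' n)] [∀ n, Module k (Y' n)]
  {d : ∀ n, Y n →ₗ[k] Y (n + 1)} {d' : ∀ n, Y' n →ₗ[k] Y' (n + 1)}
  (f : ∀ n, Y n →ₗ[k] Y' n)

/-- The map on cohomology induced by a cochain map. -/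
def Cohomology.map (hf : ∀ n y, f (n + 1) (d n y) = d' n (f n y)) (n : ℕ) :
    Cohomology d n →ₗ[k] Cohomology d' n :=
  Submodule.mapQ _ _
    ((f n).restrict (p := LinearMap.ker (d n)) (q := LinearMap.ker (d' n)) fun y hy => by
      rw [LinearMap.mem_ker] at hy ⊢
      rw [← hf, hy, map_zero]) (by
    rintro ⟨y, hy⟩ h
    change y ∈ coboundaries d n at h
    change f n y ∈ coboundaries d' n
    -- In degree zero the coboundaries are `0` by convention; in positive degree the image of a
    -- primitive is a primitive of the image.
    cases n with
    | zero =>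
      obtain rfl : y = 0 := h
      exact map_zero (f 0)
    | succ n =>
      obtain ⟨z, rfl⟩ := h
      exact ⟨f n z, (hf n z).symm⟩)

lemma Cohomology.map_mk (hf : ∀ n y, f (n + 1) (d n y) = d' n (f n y)) (n : ℕ) (z : Y n)
    (hz : d n z = 0) (hz' : d' n (f n z) = 0) :
    Cohomology.map f hf n (Cohomology.mk d n z hz) = Cohomology.mk d' n (f n z) hz' := rfl

end CohomologyMap

/-! ### Functoriality of the Hochschild complex and of the cyclic bicomplex. -/

namespace CocyclicModule

universe v
variable {k : Type v} [Field k] {X : CocyclicModule.{u} k} {Y : CocyclicModule.{u'} k}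
  (F : X.Hom Y)

lemma Hom.app_b (n : ℕ) (x : X.X n) : F.app (n + 1) (X.b n x) = Y.b n (F.app n x) := by
  simp only [b, LinearMap.sum_apply, LinearMap.smul_apply, map_sum, map_smul]
  refine Finset.sum_congr rfl fun i hi => ?_
  rw [F.app_δ n i (by rw [Finset.mem_range] at hi; omega)]

lemma Hom.app_b' (n : ℕ) (x : X.X n) : F.app (n + 1) (X.b' n x) = Y.b' n (F.app n x) := by
  simp only [b', LinearMap.sum_apply, LinearMap.smul_apply, map_sum, map_smul]
  refine Finset.sum_congr rfl fun i hi => ?_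
  rw [F.app_δ n i (by rw [Finset.mem_range] at hi; omega)]

lemma Hom.app_lam (n : ℕ) (x : X.X n) : F.app n (X.lam n x) = Y.lam n (F.app n x) := by
  simp only [lam, LinearMap.smul_apply, map_smul, F.app_τ]

lemma Hom.app_norm (n : ℕ) (x : X.X n) : F.app n (X.norm n x) = Y.norm n (F.app n x) := by
  have h : ∀ i : ℕ, F.app n ((X.lam n ^ i) x) = (Y.lam n ^ i) (F.app n x) := by
    intro i
    induction i with
    | zero => rfl
    | succ i ih => rw [pow_succ', pow_succ', Module.End.mul_apply, Module.End.mul_apply,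
        F.app_lam, ih]
  simp only [norm, LinearMap.sum_apply, map_sum, h]

lemma Hom.app_vert (p q : ℕ) (x : X.X q) :
    F.app (q + 1) (X.vert p q x) = Y.vert p q (F.app q x) := by
  unfold vert
  split_ifs
  · exact F.app_b q x
  · rw [LinearMap.neg_apply, map_neg, F.app_b', LinearMap.neg_apply]

lemma Hom.app_horiz (p q : ℕ) (x : X.X q) :
    F.app q (X.horiz p q x) = Y.horiz p q (F.app q x) := by
  unfold horiz
  split_ifs
  · rw [LinearMap.sub_apply, map_sub, F.app_lam]
    rfl
  · exact F.app_norm q x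

/-- An entry of the differential is a horizontal plus a vertical contribution, and `F` commutes with
each, whatever the column. -/
lemma Hom.tot_totD (n : ℕ) (z : X.Tot n) : F.tot (n + 1) (X.totD n z) = Y.totD n (F.tot n z) := by
  funext q
  change F.app q (X.totDEntry n q z) = Y.totDEntry n q (F.tot n z)
  rw [totDEntry, totDEntry, LinearMap.add_apply, LinearMap.add_apply, map_add]
  congr 1
  -- The row `n + 1` of the target lies in column `0` and receives no horizontal differential.
  · split_ifs with h
    · exact F.app_horiz _ _ _
    · exact map_zero _
  -- The row `0` receives no vertical differential; the row `q + 1` receives the one from row `q`.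
  · induction q using Fin.cases with
    | zero => exact map_zero _
    | succ q => exact F.app_vert _ _ _

end CocyclicModule

/-- For every `x` in `C` the maps `Ψⁿ(x) : Cⁿ(U) → Cⁿ(U')`, `u¹ ⊗ ⋯ ⊗ uⁿ ↦ x₁(u¹) ⊗ ⋯ ⊗ xₙ(uⁿ)`, form a
morphism of cocyclic modules, and there are induced maps on Hochschild and on cyclic cohomology, sending the
class of a cocycle to the class of its image. -/
theorem proposition3p1 {k : Type*} [Field k] {A U : Type u} {A' U' : Type u'}
    [Ring A] [Algebra k A] [Ring U] [Algebra k U] [Ring A'] [Algebra k A'] [Ring U'] [Algebra k U']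
    {C : Type*} [AddCommGroup C] [Module k C] [Coalgebra k C] [Coalgebra.IsCocomm k C]
    (H : HopfAlgebroid k A U) (H' : HopfAlgebroid k A' U') (Φ : HopfMeasuring C H H') (x : C) :
    ∃ F : H.cocyclic.Hom H'.cocyclic,
      (∀ n, F.app n = Φ.onCochain n x) ∧
      (∃ hoc : ∀ n, H.cocyclic.HH n →ₗ[k] H'.cocyclic.HH n,
        ∀ n z (hz : H.cocyclic.b n z = 0), ∃ hz' : H'.cocyclic.b n (F.app n z) = 0,
          hoc n (Cohomology.mk H.cocyclic.b n z hz) =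
            Cohomology.mk H'.cocyclic.b n (F.app n z) hz') ∧
      (∃ cy : ∀ n, H.cocyclic.HC n →ₗ[k] H'.cocyclic.HC n,
        ∀ n z (hz : H.cocyclic.totD n z = 0), ∃ hz' : H'.cocyclic.totD n (F.tot n z) = 0,
          cy n (Cohomology.mk H.cocyclic.totD n z hz) =
            Cohomology.mk H'.cocyclic.totD n (F.tot n z) hz') := by
  refine ⟨Φ.cocyclicHom x, fun _ => rfl, ?_, ?_⟩
  · refine ⟨Cohomology.map _ (Φ.cocyclicHom x).app_b, fun n z hz => ?_⟩
    have hz' : H'.cocyclic.b n ((Φ.cocyclicHom x).app n z) = 0 := by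
      rw [← (Φ.cocyclicHom x).app_b, hz, map_zero]
    exact ⟨hz', Cohomology.map_mk _ _ n z hz hz'⟩
  · refine ⟨Cohomology.map _ (Φ.cocyclicHom x).tot_totD, fun n z hz => ?_⟩
    have hz' : H'.cocyclic.totD n ((Φ.cocyclicHom x).tot n z) = 0 := by
      rw [← (Φ.cocyclicHom x).tot_totD, hz, map_zero]
    exact ⟨hz', Cohomology.map_mk _ _ n z hz hz'⟩
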